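/- For $n\ge 1$ and $\theta\in\mathbb R$ let $\mathbf a_n(\theta)=(1,z,\dots,z^{n-1})^{\mathrm T}\in\mathbb C^n$ with $z=e^{2\pi i\sin\theta}$, and for $\boldsymbol\theta=(\theta_x,\theta_y)$ let $\mathbf A(\boldsymbol\theta)=\mathbf a_N(\theta_x)\,\mathbf a_M(\theta_y)^{\mathrm H}\in\mathbb C^{N\times M}$. The atomic norm of $\mathbf X\in\mathbb C^{N\times M}$ is $$\|\mathbf X\|_{\mathcal A}=\inf\Big\{\sum_k|s_k| \;:\; \mathbf X=\sum_k s_k\mathbf A(\boldsymbol\theta_k)\Big\},$$ the infimum being over all finite decompositions with $s_k\in\mathbb C$ and $\boldsymbol\theta_k\in[0,2\pi]^2$; a decomposition is optimal if it attains this infimum. For $\mathbf u\in\mathbb C^n$ let $\mathbf T(\mathbf u)$ be the Hermitian Toeplitz matrix with first row $\mathbf u$. Theorem. Let $N,M\ge 1$, $K\ge 0$, and let $\mathbf X=\sum_{k=1}^K s_k^\star\,\mathbf A(\boldsymbol\theta_k^\star)$ with $s_k^\star\in\mathbb C$ and $\boldsymbol\theta_k^\star=(\theta_{x,k}^\star,\theta_{y,k}^\star)\in[0,2\pi]^2$.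 Put $$\Delta_{\min,x}=\min_{i\ne j}|\sin\theta_{x,i}^\star-\sin\theta_{x,j}^\star|,\qquad \Delta_{\min,y}=\min_{i\ne j}|\sin\theta_{y,i}^\star-\sin\theta_{y,j}^\star|,$$ where $|a-b|$ denotes the wrapped distance on the circle $\mathbb R/\mathbb Z$, that is, the distance of $a-b$ to the nearest integer, and the minimum is $+\infty$ if $K\le 1$. Suppose that $$\Delta_{\min,x}\ge\frac{1.19}{\lfloor (N-1)/4\rfloor},\qquad \Delta_{\min,y}\ge\frac{1.19}{\lfloor (M-1)/4\rfloor},$$ where $1.19/0=+\infty$. Then: 1. The decomposition $\mathbf X=\sum_{k} s_k^\star\mathbf A(\boldsymbol\theta_k^\star)$ is optimal, that is, $\|\mathbf X\|_{\mathcal A}=\sum_k|s_k^\star|$. 2. It is the only optimal decomposition: if $\mathbf X=\sum_{l} c_l\mathbf A(\boldsymbol\varphi_l)$ is optimal, then for every $l$ with $c_l\ne 0$ the atom $\mathbf A(\boldsymbol\varphi_l)$ equals some $\mathbf A(\boldsymbol\theta_k^\star)$ with $s_k^\star\neq 0$, and for every $k$ the sum of the $c_l$ over all $l$ with $\mathbf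 A(\boldsymbol\varphi_l)=\mathbf A(\boldsymbol\theta_k^\star)$ is $s_k^\star$. 3. The atomic norm is the value, attained, of a semidefinite program of size $(N+M)\times(N+M)$: $$\|\mathbf X\|_{\mathcal A}=\min_{\mathbf u_x\in\mathbb C^N,\ \mathbf u_y\in\mathbb C^M}\ \frac{1}{2\sqrt{NM}}\Big(\operatorname{tr}\mathbf T(\mathbf u_x)+\operatorname{tr}\mathbf T(\mathbf u_y)\Big)\quad\text{s.t.}\quad\begin{pmatrix}\mathbf T(\mathbf u_y)&\mathbf X^{\mathrm H}\\ \mathbf X&\mathbf T(\mathbf u_x)\end{pmatrix}\succeq 0 .$$ -/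

import Mathlib

open scoped ENNReal ComplexOrder

namespace DecoupledANM

/-- The array response vector of length `n`: the Vandermonde vector
`(1, z, z², …, z ^ (n-1))` with `z = exp (2 π i sin θ)`. The sine of the angle is the
(normalized) frequency, a point of the circle `ℝ / ℤ`. -/
noncomputable def arrayResponse (n : ℕ) (θ : ℝ) : Fin n → ℂ :=
  fun j => Complex.exp (2 * Real.pi * Complex.I * (Real.sin θ : ℂ) * ((j : ℕ) : ℂ))

/-- The rank-one matrix `A(θ) = a_N(θ_x) a_M(θ_y)ᴴ`, for `θ = (θ_x, θ_y)`. -/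
noncomputable def atom (N M : ℕ) (θ : ℝ × ℝ) : Matrix (Fin N) (Fin M) ℂ :=
  Matrix.vecMulVec (arrayResponse N θ.1) (star (arrayResponse M θ.2))

/-- The square `[0, 2π] × [0, 2π]` of admissible pairs of angles. -/
def angles : Set (ℝ × ℝ) :=
  Set.Icc 0 (2 * Real.pi) ×ˢ Set.Icc 0 (2 * Real.pi)

/-- `X = ∑ k, s k • A(θ k)`, a finite sum over admissible pairs of angles: a feasible point of
the problem that defines the atomic norm of `X`. -/
def IsDecomposition {N M K : ℕ} (X : Matrix (Fin N) (Fin M) ℂ) (s : Fin K → ℂ)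
    (θ : Fin K → ℝ × ℝ) : Prop :=
  (∀ k, θ k ∈ angles) ∧ X = ∑ k, s k • atom N M (θ k)

/-- The cost `∑ k, |s k|` of a decomposition with coefficients `s`. -/
noncomputable def cost {K : ℕ} (s : Fin K → ℂ) : ℝ := ∑ k, ‖s k‖

/-- The atomic norm: the infimum of the costs of all finite decompositions. -/
noncomputable def atomicNorm {N M : ℕ} (X : Matrix (Fin N) (Fin M) ℂ) : ℝ :=
  sInf {r : ℝ | ∃ (K : ℕ) (s : Fin K → ℂ) (θ : Fin K → ℝ × ℝ),
    IsDecomposition X s θ ∧ r = cost s}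

/-- A decomposition of `X` that attains the atomic norm. -/
def IsOptimalDecomposition {N M K : ℕ} (X : Matrix (Fin N) (Fin M) ℂ) (s : Fin K → ℂ)
    (θ : Fin K → ℝ × ℝ) : Prop :=
  IsDecomposition X s θ ∧ cost s = atomicNorm X

open Classical in
/-- The total coefficient that a decomposition `(s, θ)` gives to the matrix `B`: the sum of the
`s k` over all `k` with `A(θ k) = B`. -/
noncomputable def coefficientAt {N M K : ℕ} (s : Fin K → ℂ) (θ : Fin K → ℝ × ℝ)
    (B : Matrix (Fin N) (Fin M) ℂ) : ℂ :=
  ∑ k, if atom N M (θ k) = B then s k else 0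

/-- The wrapped distance of two reals on the circle `ℝ / ℤ` of circumference one. -/
noncomputable def wrappedDist (x y : ℝ) : ℝ := ‖((x - y : ℝ) : UnitAddCircle)‖

/-- The minimal wrapped distance of the sines of the angles `θ i`; it is `∞` if there are
fewer than two angles. -/
noncomputable def minSeparation {K : ℕ} (θ : Fin K → ℝ) : ℝ≥0∞ :=
  ⨅ (i : Fin K) (j : Fin K) (_ : i ≠ j),
    ENNReal.ofReal (wrappedDist (Real.sin (θ i)) (Real.sin (θ j)))

/-- The threshold `1.19 / ⌊(n - 1) / 4⌋`; it is `∞` for `n ≤ 4`. -/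
noncomputable def separationThreshold (n : ℕ) : ℝ≥0∞ :=
  ENNReal.ofReal 1.19 / (((n - 1) / 4 : ℕ) : ℝ≥0∞)

/-- The Toeplitz matrix with first row `u` whose entries below the diagonal are the conjugates
of those above it (it is Hermitian exactly when its diagonal is real). -/
def toeplitz {n : ℕ} (u : Fin n → ℂ) : Matrix (Fin n) (Fin n) ℂ :=
  Matrix.of fun i j =>
    if i ≤ j then u ⟨(j : ℕ) - i, lt_of_le_of_lt (Nat.sub_le _ _) j.isLt⟩
    else star (u ⟨(i : ℕ) - j, lt_of_le_of_lt (Nat.sub_le _ _) i.isLt⟩)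

/-- Feasibility in the semidefinite program: the `(M + N) × (M + N)` block matrix
`[T(u_y), Xᴴ; X, T(u_x)]` is (Hermitian) positive semidefinite. -/
def SDPFeasible {N M : ℕ} (X : Matrix (Fin N) (Fin M) ℂ) (ux : Fin N → ℂ) (uy : Fin M → ℂ) :
    Prop :=
  (Matrix.fromBlocks (toeplitz uy) X.conjTranspose X (toeplitz ux)).PosSemidef

/-- The objective `(tr T(u_x) + tr T(u_y)) / (2 √(N M))`; both traces are real at every
feasible point. -/
noncomputable def sdpObjective {N M : ℕ} (ux : Fin N → ℂ) (uy : Fin M → ℂ) : ℝ :=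
  1 / (2 * Real.sqrt ((N : ℝ) * (M : ℝ))) *
    ((toeplitz ux).trace.re + (toeplitz uy).trace.re)

end DecoupledANM

/-! The two dimensions decouple. Suppose that in each one there are polynomials `P k` in `z = exp (2
π i sin φ)`, one per node, with `P k (θ j) = δ k j` and `∑ k, |P k| ^ 2 ≤ 1`, with equality only at
nodes (`IsInterpolating`). For families `P` and `R` in the two dimensions and signs `v`, the dual
function `∑ k, v k * P k (φ_x) * conj (R k (φ_y))` is at most `1` in modulus by the
arithmetic-geometric mean inequality. Modulus `1` forces both coordinates to be nodes, and by
biorthogonality nodes of the same index. Duality then gives optimality and uniqueness.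

For the semidefinite program, `1 - ∑ k, |P k| ^ 2` is a nonnegative trigonometric polynomial, hence
a sum of squares. So `∑ k` of the quadratic form of a positive semidefinite Toeplitz matrix at the
coefficients of `P k` is at most its diagonal entry (`sum_toeplitz_form_le`). Testing the block
matrix on vectors built from `P k` and `R k` bounds the objective below by `∑ |s k|`; a sum of
rank-one matrices attains this value.

The analytic core is the one-dimensional `exists_interpolating_curve`. With `f v` the vector of
Fejér kernels centred at the nodes, the curve `A f - B (f' - H A f)` passes through the `k`-th basis
vector at the `k`-th node, with velocity orthogonal to it; it must stay inside the unit ball.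
Separation makes `A` close to the identity and `H`, `B` small. Away from the nodes, norm estimates
suffice. Near a node the curve is kernel times basis vector plus a remainder of size `O(t)`, whose
component along that vector is `O(t ^ 2)`; the curvature of the kernel outweighs both. -/

namespace DecoupledANM

open Finset

/-! ### The Fejér kernel as an average over frequencies -/

/-- The average over `j, k < M` of `φ (2 (j - k) / M)`. -/
noncomputable def freqAvg (M : ℕ) (φ : ℝ → ℝ) : ℝ :=
  (∑ j ∈ range M, ∑ k ∈ range M, φ (2 * ((j : ℝ) - k) / M)) / (M : ℝ) ^ 2

/-- The Fejér kernel in the variable `u`, of period `π M`. -/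
noncomputable def fejer (M : ℕ) (u : ℝ) : ℝ := freqAvg M fun ν => Real.cos (ν * u)

/-- The first derivative of `fejer M`. -/
noncomputable def fejer₁ (M : ℕ) (u : ℝ) : ℝ := freqAvg M fun ν => -(ν * Real.sin (ν * u))

/-- The second derivative of `fejer M`. -/
noncomputable def fejer₂ (M : ℕ) (u : ℝ) : ℝ := freqAvg M fun ν => -(ν ^ 2 * Real.cos (ν * u))

/-- The third derivative of `fejer M`. -/
noncomputable def fejer₃ (M : ℕ) (u : ℝ) : ℝ := freqAvg M fun ν => ν ^ 3 * Real.sin (ν * u)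

theorem hasDerivAt_freqAvg (M : ℕ) {φ φ' : ℝ → ℝ → ℝ} {u : ℝ}
    (h : ∀ ν, HasDerivAt (fun u => φ u ν) (φ' u ν) u) :
    HasDerivAt (fun u => freqAvg M (φ u)) (freqAvg M (φ' u)) u := by
  unfold freqAvg
  exact (HasDerivAt.fun_sum fun j _ => HasDerivAt.fun_sum fun k _ => h _).div_const _

theorem hasDerivAt_fejer (M : ℕ) (u : ℝ) : HasDerivAt (fejer M) (fejer₁ M u) u := by
  refine hasDerivAt_freqAvg M (φ := fun u ν => Real.cos (ν * u))
    (φ' := fun u ν => -(ν * Real.sin (ν * u))) fun ν => ?_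
  have := ((hasDerivAt_id u).const_mul ν).cos
  simpa [mul_comm] using this

theorem hasDerivAt_fejer₁ (M : ℕ) (u : ℝ) : HasDerivAt (fejer₁ M) (fejer₂ M u) u := by
  refine hasDerivAt_freqAvg M (φ := fun u ν => -(ν * Real.sin (ν * u)))
    (φ' := fun u ν => -(ν ^ 2 * Real.cos (ν * u))) fun ν => ?_
  have := ((((hasDerivAt_id u).const_mul ν).sin).const_mul ν).fun_neg
  exact this.congr_deriv (by simp; ring)

theorem hasDerivAt_fejer₂ (M : ℕ) (u : ℝ) : HasDerivAt (fejer₂ M) (fejer₃ M u) u := by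
  refine hasDerivAt_freqAvg M (φ := fun u ν => -(ν ^ 2 * Real.cos (ν * u)))
    (φ' := fun u ν => ν ^ 3 * Real.sin (ν * u)) fun ν => ?_
  have := ((((hasDerivAt_id u).const_mul ν).cos).const_mul (ν ^ 2)).fun_neg
  exact this.congr_deriv (by simp; ring)

theorem freqAvg_congr {M : ℕ} {φ ψ : ℝ → ℝ}
    (h : ∀ j < M, ∀ k < M, φ (2 * ((j : ℝ) - k) / M) = ψ (2 * ((j : ℝ) - k) / M)) :
    freqAvg M φ = freqAvg M ψ := by
  unfold freqAvg
  congr 1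
  exact sum_congr rfl fun j hj => sum_congr rfl fun k hk =>
    h j (mem_range.1 hj) k (mem_range.1 hk)

theorem freqAvg_mono {M : ℕ} {φ ψ : ℝ → ℝ} (h : ∀ ν, |ν| ≤ 2 → φ ν ≤ ψ ν) :
    freqAvg M φ ≤ freqAvg M ψ := by
  unfold freqAvg
  gcongr with j hj k hk
  apply h
  have hj := mem_range.1 hj
  have hk := mem_range.1 hk
  have hM : (0 : ℝ) < M := by exact_mod_cast (Nat.zero_le j).trans_lt hj
  have hj' : (j : ℝ) < M := by exact_mod_cast hj
  have hk' : (k : ℝ) < M := by exact_mod_cast hk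
  rw [abs_div, abs_of_pos hM, div_le_iff₀ hM, abs_mul, abs_of_pos (by norm_num : (0:ℝ) < 2)]
  gcongr
  rw [abs_le]
  constructor <;> linarith [Nat.cast_nonneg (α := ℝ) j, Nat.cast_nonneg (α := ℝ) k]

theorem freqAvg_abs_le (M : ℕ) (φ : ℝ → ℝ) : |freqAvg M φ| ≤ freqAvg M fun ν => |φ ν| := by
  unfold freqAvg
  rw [abs_div, abs_of_nonneg (by positivity : (0 : ℝ) ≤ (M : ℝ) ^ 2)]
  gcongr
  exact (abs_sum_le_sum_abs _ _).trans (sum_le_sum fun j _ => abs_sum_le_sum_abs _ _)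

theorem freqAvg_const_mul (M : ℕ) (c : ℝ) (φ : ℝ → ℝ) :
    freqAvg M (fun ν => c * φ ν) = c * freqAvg M φ := by
  simp only [freqAvg, ← mul_sum, mul_div_assoc]

theorem freqAvg_add (M : ℕ) (φ ψ : ℝ → ℝ) :
    freqAvg M (fun ν => φ ν + ψ ν) = freqAvg M φ + freqAvg M ψ := by
  simp only [freqAvg, sum_add_distrib, add_div]

theorem freqAvg_const {M : ℕ} (hM : 0 < M) (c : ℝ) : freqAvg M (fun _ => c) = c := by
  have : (M : ℝ) ≠ 0 := by positivity
  simp [freqAvg]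
  field_simp

theorem freqAvg_sq {M : ℕ} (hM : 0 < M) :
    freqAvg M (fun ν => ν ^ 2) = 2 / 3 * (1 - 1 / (M : ℝ) ^ 2) := by
  have h0 : (M : ℝ) ≠ 0 := by positivity
  have h1 : ∀ n : ℕ, ∑ j ∈ range n, (j : ℝ) = n * (n - 1) / 2 := by
    intro n
    induction n with
    | zero => simp
    | succ n ih => rw [sum_range_succ, ih]; push_cast; ring
  have h2 : ∀ n : ℕ, ∑ j ∈ range n, (j : ℝ) ^ 2 = n * (n - 1) * (2 * n - 1) / 6 := by
    intro n
    induction n with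
    | zero => simp
    | succ n ih => rw [sum_range_succ, ih]; push_cast; ring
  have h3 : ∑ j ∈ range M, ∑ k ∈ range M, (2 * ((j : ℝ) - k) / M) ^ 2 =
      4 / (M : ℝ) ^ 2 * (∑ j ∈ range M, ∑ k ∈ range M,
        ((j : ℝ) ^ 2 + (k : ℝ) ^ 2 - 2 * j * k)) := by
    simp only [mul_sum]
    refine sum_congr rfl fun j _ => sum_congr rfl fun k _ => ?_
    field_simp
    ring
  unfold freqAvg
  rw [h3]
  simp only [sum_sub_distrib, sum_add_distrib, ← mul_sum, ← sum_mul, sum_const, card_range,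
    nsmul_eq_mul, h1, h2]
  field_simp
  ring

theorem freqAvg_sq_le {M : ℕ} (hM : 0 < M) : freqAvg M (fun ν => ν ^ 2) ≤ 2 / 3 := by
  rw [freqAvg_sq hM]
  have : 0 ≤ 1 / (M : ℝ) ^ 2 := by positivity
  linarith

theorem fejer_zero {M : ℕ} (hM : 0 < M) : fejer M 0 = 1 := by
  simp [fejer, freqAvg_const hM]

theorem fejer₁_zero (M : ℕ) : fejer₁ M 0 = 0 := by
  simp [fejer₁, freqAvg]

theorem fejer₂_zero_le {M : ℕ} (hM : 7 ≤ M) : fejer₂ M 0 ≤ -(653 / 1000) := by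
  have h : fejer₂ M 0 = -1 * freqAvg M (fun ν => ν ^ 2) := by
    rw [← freqAvg_const_mul]
    simp [fejer₂]
  rw [h, freqAvg_sq (by omega)]
  have hM' : (7 : ℝ) ≤ M := by exact_mod_cast hM
  have : 1 / (M : ℝ) ^ 2 ≤ 1 / 7 ^ 2 := by gcongr
  norm_num at this ⊢
  linarith

theorem fejer_neg (M : ℕ) (u : ℝ) : fejer M (-u) = fejer M u := by
  simp [fejer]

theorem fejer₁_neg (M : ℕ) (u : ℝ) : fejer₁ M (-u) = -fejer₁ M u := by
  simp [fejer₁, freqAvg, sum_neg_distrib, neg_div]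

theorem abs_fejer₁_le {M : ℕ} (hM : 0 < M) (u : ℝ) : |fejer₁ M u| ≤ 5 / 6 := by
  refine (freqAvg_abs_le M _).trans ?_
  have h : freqAvg M (fun ν => |-(ν * Real.sin (ν * u))|) ≤
      freqAvg M fun ν => 1 / 2 * ν ^ 2 + 1 / 2 := by
    refine freqAvg_mono fun ν _ => ?_
    rw [abs_neg, abs_mul]
    -- `|ν| ≤ (ν ^ 2 + 1) / 2` reduces the first moment to the second, which is at most `2 / 3`.
    have := Real.abs_sin_le_one (ν * u)
    nlinarith [sq_nonneg (|ν| - 1), sq_abs ν, abs_nonneg ν, abs_nonneg (Real.sin (ν * u))]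
  rw [freqAvg_add, freqAvg_const_mul, freqAvg_const hM] at h
  linarith [freqAvg_sq_le hM]

theorem abs_fejer₁_le_mul {M : ℕ} (hM : 0 < M) (u : ℝ) : |fejer₁ M u| ≤ 2 / 3 * |u| := by
  refine (freqAvg_abs_le M _).trans ?_
  have h : freqAvg M (fun ν => |-(ν * Real.sin (ν * u))|) ≤ freqAvg M fun ν => |u| * ν ^ 2 := by
    refine freqAvg_mono fun ν _ => ?_
    rw [abs_neg, abs_mul]
    calc |ν| * |Real.sin (ν * u)| ≤ |ν| * |ν * u| := mul_le_mul_of_nonneg_left Real.abs_sin_le_abs (abs_nonneg ν)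
      _ = |u| * ν ^ 2 := by rw [abs_mul, ← sq_abs ν]; ring
  rw [freqAvg_const_mul] at h
  nlinarith [freqAvg_sq_le hM, abs_nonneg u]

theorem abs_fejer₂_le {M : ℕ} (hM : 0 < M) (u : ℝ) : |fejer₂ M u| ≤ 2 / 3 := by
  refine (freqAvg_abs_le M _).trans (le_trans (freqAvg_mono fun ν _ => ?_) (freqAvg_sq_le hM))
  rw [abs_neg, abs_mul, abs_of_nonneg (sq_nonneg ν)]
  exact mul_le_of_le_one_right (sq_nonneg ν) (Real.abs_cos_le_one _)

theorem abs_fejer₃_le {M : ℕ} (hM : 0 < M) (u : ℝ) : |fejer₃ M u| ≤ 4 / 3 := by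
  refine (freqAvg_abs_le M _).trans ?_
  have h : freqAvg M (fun ν => |ν ^ 3 * Real.sin (ν * u)|) ≤ freqAvg M fun ν => 2 * ν ^ 2 := by
    refine freqAvg_mono fun ν hν => ?_
    rw [abs_mul, abs_pow]
    calc |ν| ^ 3 * |Real.sin (ν * u)| ≤ |ν| ^ 3 * 1 := by
          gcongr; exact Real.abs_sin_le_one _
      _ = |ν| * ν ^ 2 := by rw [← sq_abs ν]; ring
      _ ≤ 2 * ν ^ 2 := by gcongr
  rw [freqAvg_const_mul] at h
  linarith [freqAvg_sq_le hM]

theorem fejer_add_int_mul (M : ℕ) (u : ℝ) (n : ℤ) :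
    fejer M (u + n * (Real.pi * M)) = fejer M u := by
  refine freqAvg_congr fun j hj k _ => ?_
  have hM : (M : ℝ) ≠ 0 := by exact_mod_cast (Nat.zero_le j |>.trans_lt hj).ne'
  have : 2 * ((j : ℝ) - k) / M * (u + n * (Real.pi * M)) =
      2 * ((j : ℝ) - k) / M * u + (((j : ℤ) - k) * n : ℤ) * (2 * Real.pi) := by
    push_cast; field_simp
  rw [this, Real.cos_add_int_mul_two_pi]

theorem fejer₁_add_int_mul (M : ℕ) (u : ℝ) (n : ℤ) :
    fejer₁ M (u + n * (Real.pi * M)) = fejer₁ M u := by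
  refine freqAvg_congr fun j hj k _ => ?_
  have hM : (M : ℝ) ≠ 0 := by exact_mod_cast (Nat.zero_le j |>.trans_lt hj).ne'
  have : 2 * ((j : ℝ) - k) / M * (u + n * (Real.pi * M)) =
      2 * ((j : ℝ) - k) / M * u + (((j : ℤ) - k) * n : ℤ) * (2 * Real.pi) := by
    push_cast; field_simp
  rw [this, Real.sin_add_int_mul_two_pi]

theorem fejer₂_add_int_mul (M : ℕ) (u : ℝ) (n : ℤ) :
    fejer₂ M (u + n * (Real.pi * M)) = fejer₂ M u := by
  refine freqAvg_congr fun j hj k _ => ?_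
  have hM : (M : ℝ) ≠ 0 := by exact_mod_cast (Nat.zero_le j |>.trans_lt hj).ne'
  have : 2 * ((j : ℝ) - k) / M * (u + n * (Real.pi * M)) =
      2 * ((j : ℝ) - k) / M * u + (((j : ℤ) - k) * n : ℤ) * (2 * Real.pi) := by
    push_cast; field_simp
  rw [this, Real.cos_add_int_mul_two_pi]

/-! ### Closed form, decay and pointwise bounds of the kernel -/

theorem sin_mul_sum_cos (M : ℕ) (w : ℝ) :
    Real.sin w * ∑ j ∈ range M, Real.cos (2 * j * w) =
      Real.sin (M * w) * Real.cos ((M - 1) * w) := by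
  induction M with
  | zero => simp
  | succ n ih =>
    rw [sum_range_succ, mul_add, ih]
    have h1 : ((n + 1 : ℕ) : ℝ) * w = n * w + w := by push_cast; ring
    have h2 : (((n + 1 : ℕ) : ℝ) - 1) * w = n * w := by push_cast; ring
    have h3 : ((n : ℝ) - 1) * w = n * w - w := by ring
    have h4 : 2 * (n : ℝ) * w = n * w + n * w := by ring
    rw [h1, h2, h3, h4, Real.sin_add, Real.cos_sub, Real.cos_add]
    ring

theorem sin_mul_sum_sin (M : ℕ) (w : ℝ) :
    Real.sin w * ∑ j ∈ range M, Real.sin (2 * j * w) =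
      Real.sin (M * w) * Real.sin ((M - 1) * w) := by
  induction M with
  | zero => simp
  | succ n ih =>
    rw [sum_range_succ, mul_add, ih]
    have h1 : ((n + 1 : ℕ) : ℝ) * w = n * w + w := by push_cast; ring
    have h2 : (((n + 1 : ℕ) : ℝ) - 1) * w = n * w := by push_cast; ring
    have h3 : ((n : ℝ) - 1) * w = n * w - w := by ring
    have h4 : 2 * (n : ℝ) * w = n * w + n * w := by ring
    rw [h1, h2, h3, h4, Real.sin_add, Real.sin_sub, Real.sin_add]
    ring

/-- The double sum is `|∑ j, exp (2 i j u / M)| ^ 2` multiplied out, whence positivity and, through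
the geometric sum, the closed form. -/
theorem fejer_eq_sq_add_sq (M : ℕ) (u : ℝ) :
    fejer M u = ((∑ j ∈ range M, Real.cos (2 * j * (u / M))) ^ 2 +
      (∑ j ∈ range M, Real.sin (2 * j * (u / M))) ^ 2) / (M : ℝ) ^ 2 := by
  unfold fejer freqAvg
  congr 1
  rw [sq, sq, sum_mul_sum, sum_mul_sum, ← sum_add_distrib]
  refine sum_congr rfl fun j _ => ?_
  rw [← sum_add_distrib]
  refine sum_congr rfl fun k _ => ?_
  rw [← Real.cos_sub]
  ring_nf

theorem fejer_nonneg (M : ℕ) (u : ℝ) : 0 ≤ fejer M u := by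
  rw [fejer_eq_sq_add_sq]; positivity

/-- Kept free of division, the closed form holds also at the zeros of the sine and can be
differentiated everywhere; its first two derivatives control `fejer₁` and `fejer₂`. -/
theorem sin_sq_mul_fejer {M : ℕ} (hM : 0 < M) (u : ℝ) :
    (M * Real.sin (u / M)) ^ 2 * fejer M u = Real.sin u ^ 2 := by
  have h0 : (M : ℝ) ≠ 0 := by positivity
  have h1 := sin_mul_sum_cos M (u / M)
  have h2 := sin_mul_sum_sin M (u / M)
  have h3 : (M : ℝ) * (u / M) = u := by field_simp
  rw [h3] at h1 h2
  rw [fejer_eq_sq_add_sq]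
  have : (M * Real.sin (u / M)) ^ 2 * (((∑ j ∈ range M, Real.cos (2 * j * (u / M))) ^ 2 +
      (∑ j ∈ range M, Real.sin (2 * j * (u / M))) ^ 2) / (M : ℝ) ^ 2) =
      (Real.sin (u / M) * ∑ j ∈ range M, Real.cos (2 * j * (u / M))) ^ 2 +
      (Real.sin (u / M) * ∑ j ∈ range M, Real.sin (2 * j * (u / M))) ^ 2 := by
    field_simp
  rw [this, h1, h2]
  linear_combination Real.sin u ^ 2 * Real.sin_sq_add_cos_sq ((M - 1) * (u / M))

/-- The denominator of the Fejér kernel. -/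
noncomputable def chord (M : ℕ) (u : ℝ) : ℝ := M * |Real.sin (u / M)|

theorem chord_sq (M : ℕ) (u : ℝ) : chord M u ^ 2 = (M * Real.sin (u / M)) ^ 2 := by
  rw [chord, mul_pow, sq_abs, mul_pow]

theorem two_div_pi_mul_abs_le_chord {M : ℕ} (hM : 0 < M) {u : ℝ}
    (hu : |u| ≤ Real.pi * M / 2) : 2 / Real.pi * |u| ≤ chord M u := by
  have h0 : (0 : ℝ) < M := by positivity
  have h1 : |u / M| ≤ Real.pi / 2 := by
    rw [abs_div, abs_of_pos h0, div_le_iff₀ h0]; linarith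
  have h2 := Real.mul_abs_le_abs_sin h1
  rw [abs_div, abs_of_pos h0] at h2
  calc 2 / Real.pi * |u| = M * (2 / Real.pi * (|u| / M)) := by field_simp
    _ ≤ chord M u := by unfold chord; gcongr

theorem fejer_le_inv_chord_sq {M : ℕ} (hM : 0 < M) {u : ℝ} (hY : 0 < chord M u) :
    fejer M u ≤ 1 / chord M u ^ 2 := by
  rw [le_div_iff₀ (by positivity), mul_comm, chord_sq, sin_sq_mul_fejer hM]
  exact Real.sin_sq_le_one u

theorem hasDerivAt_mul_sin {M : ℕ} (hM : 0 < M) (u : ℝ) :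
    HasDerivAt (fun u => (M : ℝ) * Real.sin (u / M)) (Real.cos (u / M)) u := by
  have h0 : (M : ℝ) ≠ 0 := by positivity
  exact ((((hasDerivAt_id u).div_const (M : ℝ)).sin).const_mul (M : ℝ)).congr_deriv
    (by simp; field_simp)

theorem hasDerivAt_cos_div {M : ℕ} (u : ℝ) :
    HasDerivAt (fun u => Real.cos (u / M)) (-(Real.sin (u / M) / M)) u :=
  (((hasDerivAt_id u).div_const (M : ℝ)).cos).congr_deriv (by simp; ring)

theorem sin_sq_mul_fejer₁ {M : ℕ} (hM : 0 < M) (u : ℝ) :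
    (M * Real.sin (u / M)) ^ 2 * fejer₁ M u +
      2 * (M * Real.sin (u / M)) * Real.cos (u / M) * fejer M u = Real.sin (2 * u) := by
  have h1 := ((hasDerivAt_mul_sin hM u).fun_pow 2).fun_mul (hasDerivAt_fejer M u)
  have h2 : HasDerivAt (fun u => Real.sin u ^ 2) (2 * Real.sin u * Real.cos u) u :=
    ((Real.hasDerivAt_sin u).fun_pow 2).congr_deriv (by simp)
  have h3 : (fun u => ((M : ℝ) * Real.sin (u / M)) ^ 2 * fejer M u) =
      fun u => Real.sin u ^ 2 := funext (sin_sq_mul_fejer hM)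
  rw [h3] at h1
  have := h1.unique h2
  rw [Real.sin_two_mul, ← this]
  simp
  ring

theorem sin_sq_mul_fejer₂ {M : ℕ} (hM : 0 < M) (u : ℝ) :
    (M * Real.sin (u / M)) ^ 2 * fejer₂ M u +
      4 * (M * Real.sin (u / M)) * Real.cos (u / M) * fejer₁ M u +
      2 * Real.cos (2 * (u / M)) * fejer M u = 2 * Real.cos (2 * u) := by
  have h0 : (M : ℝ) ≠ 0 := by positivity
  have h1 := (((hasDerivAt_mul_sin hM u).fun_pow 2).fun_mul (hasDerivAt_fejer₁ M u)).fun_add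
    ((((hasDerivAt_mul_sin hM u).const_mul 2).fun_mul (hasDerivAt_cos_div (M := M) u)).fun_mul
      (hasDerivAt_fejer M u))
  have h2 : HasDerivAt (fun u => Real.sin (2 * u)) (2 * Real.cos (2 * u)) u :=
    (((hasDerivAt_id u).const_mul 2).sin).congr_deriv (by simp; ring)
  rw [funext (sin_sq_mul_fejer₁ hM)] at h1
  rw [← h1.unique h2, Real.cos_two_mul']
  simp
  field_simp
  ring

/-- The differentiated closed form is solved for `fejer₁`; the leftover term `2 * chord * fejer` is
at most `2 / chord ≤ 2 / κ`. -/
theorem abs_fejer₁_le_chord {M : ℕ} (hM : 0 < M) {u κ : ℝ} (hκ : 0 < κ) (hY : κ ≤ chord M u) :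
    |fejer₁ M u| ≤ (1 + 2 / κ) * (1 / chord M u ^ 2) := by
  have hY0 : 0 < chord M u := hκ.trans_le hY
  have h := sin_sq_mul_fejer₁ hM u
  have hF := fejer_le_inv_chord_sq hM hY0
  have hF0 := fejer_nonneg M u
  have h1 : chord M u ^ 2 * |fejer₁ M u| ≤ 1 + 2 * chord M u * fejer M u := by
    have e : chord M u ^ 2 * |fejer₁ M u| =
        |Real.sin (2 * u) - 2 * (M * Real.sin (u / M)) * Real.cos (u / M) * fejer M u| := by
      rw [← h, chord_sq, add_sub_cancel_right, abs_mul, abs_sq]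
    rw [e]
    refine (abs_sub _ _).trans (add_le_add (Real.abs_sin_le_one _) ?_)
    rw [abs_mul, abs_mul, abs_mul, abs_mul, abs_of_nonneg hF0, Nat.abs_cast, abs_two]
    have := Real.abs_cos_le_one (u / M)
    have h2 : 0 ≤ 2 * chord M u := by positivity
    have h3 : 2 * chord M u * |Real.cos (u / M)| ≤ 2 * chord M u * 1 := by gcongr
    unfold chord at h3 ⊢
    nlinarith
  have h2 : 2 * chord M u * fejer M u ≤ 2 / κ := by
    calc 2 * chord M u * fejer M u ≤ 2 * chord M u * (1 / chord M u ^ 2) := by gcongr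
      _ = 2 / chord M u := by field_simp
      _ ≤ 2 / κ := by gcongr
  rw [mul_one_div, le_div_iff₀ (by positivity)]
  linarith

theorem abs_fejer₂_le_chord {M : ℕ} (hM : 0 < M) {u κ : ℝ} (hκ : 0 < κ) (hY : κ ≤ chord M u) :
    |fejer₂ M u| ≤ (2 + 4 / κ + 10 / κ ^ 2) * (1 / chord M u ^ 2) := by
  have hY0 : 0 < chord M u := hκ.trans_le hY
  have h := sin_sq_mul_fejer₂ hM u
  have hF := fejer_le_inv_chord_sq hM hY0
  have hF0 := fejer_nonneg M u
  have hF1 := abs_fejer₁_le_chord hM hκ hY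
  have h1 : chord M u ^ 2 * |fejer₂ M u| ≤
      2 + 4 * chord M u * |fejer₁ M u| + 2 * fejer M u := by
    have e : chord M u ^ 2 * |fejer₂ M u| = |2 * Real.cos (2 * u) -
        4 * (M * Real.sin (u / M)) * Real.cos (u / M) * fejer₁ M u -
        2 * Real.cos (2 * (u / M)) * fejer M u| := by
      rw [← h, chord_sq]
      rw [show ∀ a b c : ℝ, a + b + c - b - c = a by intros; ring, abs_mul,
        abs_sq]
    rw [e]
    refine (abs_sub _ _).trans (add_le_add ((abs_sub _ _).trans (add_le_add ?_ ?_)) ?_)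
    · rw [abs_mul, abs_two]
      linarith [Real.abs_cos_le_one (2 * u)]
    · rw [abs_mul, abs_mul, abs_mul, abs_mul, Nat.abs_cast]
      have h3 : 4 * chord M u * |Real.cos (u / M)| ≤ 4 * chord M u * 1 := by
        have := Real.abs_cos_le_one (u / M)
        gcongr
      rw [show |(4 : ℝ)| = 4 by norm_num]
      unfold chord at h3 ⊢
      nlinarith [abs_nonneg (fejer₁ M u)]
    · rw [abs_mul, abs_mul, abs_two, abs_of_nonneg hF0]
      have := Real.abs_cos_le_one (2 * (u / M))
      nlinarith
  have h2 : 4 * chord M u * |fejer₁ M u| ≤ 4 / κ + 8 / κ ^ 2 := by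
    calc 4 * chord M u * |fejer₁ M u|
        ≤ 4 * chord M u * ((1 + 2 / κ) * (1 / chord M u ^ 2)) := by gcongr
      _ = 4 * (1 + 2 / κ) / chord M u := by field_simp
      _ ≤ 4 * (1 + 2 / κ) / κ := by gcongr
      _ = _ := by field_simp; ring
  have h3 : 2 * fejer M u ≤ 2 / κ ^ 2 := by
    calc 2 * fejer M u ≤ 2 * (1 / chord M u ^ 2) := by gcongr
      _ ≤ 2 * (1 / κ ^ 2) := by gcongr
      _ = _ := by ring
  rw [mul_one_div, le_div_iff₀ (by positivity)]
  have : 10 / κ ^ 2 = 8 / κ ^ 2 + 2 / κ ^ 2 := by ring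
  linarith

/-- From `sin x ≥ x - x ^ 3 / 6` at `x = u / M`; the constant is `294 = 6 * 7 ^ 2`. -/
theorem mul_le_chord {M : ℕ} (hM : 7 ≤ M) {u : ℝ} (hu : 0 ≤ u) :
    u * (1 - u ^ 2 / 294) ≤ chord M u := by
  have hM' : (7 : ℝ) ≤ M := by exact_mod_cast hM
  have h := Real.sin_ge_sub_cube (x := u / M) (by positivity)
  calc u * (1 - u ^ 2 / 294) = u - u ^ 3 / 6 * (1 / 7 ^ 2) := by ring
    _ ≤ u - u ^ 3 / 6 * (1 / (M : ℝ) ^ 2) := by gcongr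
    _ = M * (u / M - (u / M) ^ 3 / 6) := by field_simp
    _ ≤ M * Real.sin (u / M) := by gcongr
    _ ≤ chord M u := by unfold chord; gcongr; exact le_abs_self _

theorem fejer_le_sq_of_sin_le {M : ℕ} (hM : 7 ≤ M) {u d : ℝ} (hu : 0 < u) (hu2 : u ≤ 2)
    (h : Real.sin u ≤ d * (u * (1 - u ^ 2 / 294))) : fejer M u ≤ d ^ 2 := by
  have hs : 0 ≤ Real.sin u := Real.sin_nonneg_of_nonneg_of_le_pi hu.le
    (hu2.trans (by linarith [Real.pi_gt_three]))
  have hb : 0 < u * (1 - u ^ 2 / 294) := by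
    have : 0 < 1 - u ^ 2 / 294 := by nlinarith
    positivity
  have hc := mul_le_chord hM hu.le
  have hc0 := hb.trans_le hc
  have hd : 0 ≤ d := by
    by_contra hd
    nlinarith
  have h1 : Real.sin u ≤ d * chord M u := h.trans (by gcongr)
  have h2 := sin_sq_mul_fejer (by omega : 0 < M) u
  rw [← chord_sq] at h2
  have h3 : chord M u ^ 2 * fejer M u ≤ chord M u ^ 2 * d ^ 2 := by
    rw [h2, ← mul_pow, mul_comm]
    gcongr
  exact le_of_mul_le_mul_left h3 (by positivity)

/-- The coefficient `48 / 100` is the curvature that has to absorb all remainders near a node in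
`exists_interpolating_curve`. -/
theorem fejer_sq_le_near {M : ℕ} (hM : 7 ≤ M) {u : ℝ} (hu : |u| ≤ 1) :
    fejer M u ^ 2 ≤ 1 - 48 / 100 * u ^ 2 := by
  wlog h0 : 0 ≤ u generalizing u
  · have := this (u := -u) (by rwa [abs_neg]) (by linarith)
    rwa [fejer_neg, neg_sq] at this
  rcases h0.eq_or_lt with rfl | h0
  · simp [fejer_zero (by omega : 0 < M)]
  have hu1 : u ≤ 1 := (le_abs_self u).trans hu
  have hs := (abs_le.1 (Real.sin_bound hu)).2
  rw [abs_of_pos h0] at hs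
  have hq : u ^ 2 ≤ 1 := by nlinarith
  have hq0 : 0 ≤ u ^ 2 := sq_nonneg u
  have h1 : fejer M u ≤ (1 - 153 / 1000 * u ^ 2) ^ 2 := by
    refine fejer_le_sq_of_sin_le hM h0 (by linarith) ?_
    have h2 : Real.sin u ≤ u * (1 - u ^ 2 / 6 + (u ^ 2) ^ 2 / 100) := by
      nlinarith
    refine h2.trans ?_
    rw [mul_left_comm]
    gcongr
    nlinarith
  generalize u ^ 2 = q at *
  have h3 : fejer M u ≤ 1 - 282 / 1000 * q := by nlinarith
  calc fejer M u ^ 2 ≤ (1 - 282 / 1000 * q) ^ 2 := by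
        gcongr; exact fejer_nonneg M u
    _ ≤ _ := by nlinarith

theorem fejer_le_far {M : ℕ} (hM : 7 ≤ M) {u : ℝ} (hu : 1 ≤ |u|) (hu' : |u| ≤ Real.pi * M / 2) :
    fejer M u ≤ 718 / 1000 := by
  wlog h0 : 0 ≤ u generalizing u
  · have := this (u := -u) (by rwa [abs_neg]) (by rwa [abs_neg]) (by linarith)
    rwa [fejer_neg] at this
  rw [abs_of_nonneg h0] at hu
  by_cases h2 : u ≤ 2
  · have h : fejer M u ≤ (847 / 1000) ^ 2 := by
      refine fejer_le_sq_of_sin_le hM (by linarith) h2 ?_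
      have h1 := (abs_le.1 (Real.sin_bound (x := 1) (by norm_num))).2
      have hc : 0 ≤ Real.cos 1 := (Real.cos_pos_of_le_one (by norm_num)).le
      have e : Real.sin u = Real.sin 1 * Real.cos (u - 1) + Real.cos 1 * Real.sin (u - 1) := by
        rw [← Real.sin_add]; ring_nf
      have hs1 : 0 ≤ Real.sin 1 := Real.sin_nonneg_of_nonneg_of_le_pi zero_le_one
        (by linarith [Real.pi_gt_three])
      -- On `[1, 2]` the sine lies below its tangent at `1`.
      have h3 : Real.sin u ≤ Real.sin 1 * 1 + Real.cos 1 * (u - 1) := by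
        rw [e]
        gcongr
        · exact Real.cos_le_one _
        · exact Real.sin_le (by linarith)
      have h4 : Real.cos 1 * (u - 1) ≤ 5 / 9 * (u - 1) :=
        mul_le_mul_of_nonneg_right Real.cos_one_le (by linarith)
      norm_num at h1
      nlinarith [mul_nonneg (sub_nonneg.2 hu) (sub_nonneg.2 h2),
        mul_nonneg (mul_nonneg (sub_nonneg.2 hu) (sub_nonneg.2 h2)) h0]
    norm_num at h
    linarith
  · push Not at h2
    have h3 := two_div_pi_mul_abs_le_chord (by omega : 0 < M) hu'
    rw [abs_of_nonneg h0] at h3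
    have h4 : 127 / 100 ≤ 2 / Real.pi * u := by
      rw [div_mul_eq_mul_div, le_div_iff₀ Real.pi_pos]
      nlinarith [Real.pi_lt_d4]
    have h5 : 127 / 100 ≤ chord M u := h4.trans h3
    refine (fejer_le_inv_chord_sq (by omega) (by linarith)).trans ?_
    rw [div_le_iff₀ (by positivity)]
    nlinarith

/-! ### Sums of the kernel over separated points -/

/-- The integers `⌊ρ j / b⌋₊` are positive and, by separation, distinct, so the sum is dominated by
`ζ(2) / b ^ 2`. -/
theorem sum_inv_sq_le_of_pos {ι : Type*} (J : Finset ι) (ρ : ι → ℝ) {b : ℝ} (hb : 0 < b)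
    (h1 : ∀ j ∈ J, b ≤ ρ j) (h2 : ∀ i ∈ J, ∀ j ∈ J, i ≠ j → b ≤ |ρ i - ρ j|) :
    ∑ j ∈ J, 1 / ρ j ^ 2 ≤ Real.pi ^ 2 / 6 / b ^ 2 := by
  classical
  have hfl : ∀ j ∈ J, (⌊ρ j / b⌋₊ : ℝ) ≤ ρ j / b := fun j hj =>
    Nat.floor_le (div_nonneg (hb.le.trans (h1 j hj)) hb.le)
  have hinj : Set.InjOn (fun j => ⌊ρ j / b⌋₊) J := by
    intro i hi j hj hij
    by_contra hne
    have hij : ⌊ρ i / b⌋₊ = ⌊ρ j / b⌋₊ := hij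
    have a1 := hfl i hi
    have a2 := hfl j hj
    have a3 := Nat.lt_floor_add_one (ρ i / b)
    have a4 := Nat.lt_floor_add_one (ρ j / b)
    rw [hij] at a1 a3
    have a5 : |ρ i / b - ρ j / b| < 1 := by rw [abs_lt]; constructor <;> linarith
    rw [← sub_div, abs_div, abs_of_pos hb, div_lt_one hb] at a5
    linarith [h2 i hi j hj hne]
  calc ∑ j ∈ J, 1 / ρ j ^ 2 ≤ ∑ j ∈ J, 1 / b ^ 2 * (1 / ((⌊ρ j / b⌋₊ : ℕ) : ℝ) ^ 2) := by
        refine sum_le_sum fun j hj => ?_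
        have hpos : (0 : ℝ) < ⌊ρ j / b⌋₊ := by
          exact_mod_cast Nat.floor_pos.2 ((one_le_div hb).2 (h1 j hj))
        have := hfl j hj
        rw [le_div_iff₀ hb] at this
        rw [one_div_mul_one_div, ← mul_pow, mul_comm b]
        gcongr
    _ = 1 / b ^ 2 * ∑ n ∈ J.image (fun j => ⌊ρ j / b⌋₊), 1 / (n : ℝ) ^ 2 := by
        rw [sum_image hinj, mul_sum]
    _ ≤ 1 / b ^ 2 * (Real.pi ^ 2 / 6) := by
        gcongr
        exact sum_le_hasSum _ (fun n _ => by positivity) hasSum_zeta_two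
    _ = _ := by ring

theorem sum_inv_sq_le {ι : Type*} (J : Finset ι) (ρ : ι → ℝ) {b : ℝ} (hb : 0 < b)
    (h1 : ∀ j ∈ J, b ≤ |ρ j|) (h2 : ∀ i ∈ J, ∀ j ∈ J, i ≠ j → b ≤ |ρ i - ρ j|) :
    ∑ j ∈ J, 1 / ρ j ^ 2 ≤ Real.pi ^ 2 / 3 / b ^ 2 := by
  classical
  rw [← sum_filter_add_sum_filter_not J (fun j => 0 ≤ ρ j)]
  have p := sum_inv_sq_le_of_pos (J.filter fun j => 0 ≤ ρ j) ρ hb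
    (fun j hj => by
      have := h1 j (mem_filter.1 hj).1
      rwa [abs_of_nonneg (mem_filter.1 hj).2] at this)
    (fun i hi j hj => h2 i (mem_filter.1 hi).1 j (mem_filter.1 hj).1)
  have n := sum_inv_sq_le_of_pos (J.filter fun j => ¬ 0 ≤ ρ j) (fun j => -ρ j) hb
    (fun j hj => by
      have := h1 j (mem_filter.1 hj).1
      rwa [abs_of_neg (not_le.1 (mem_filter.1 hj).2)] at this)
    (fun i hi j hj hij => by
      rw [neg_sub_neg, abs_sub_comm]
      exact h2 i (mem_filter.1 hi).1 j (mem_filter.1 hj).1 hij)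
  simp only [neg_sq] at n
  calc _ ≤ Real.pi ^ 2 / 6 / b ^ 2 + Real.pi ^ 2 / 6 / b ^ 2 := add_le_add p n
    _ = _ := by ring

/-- Since `chord` is at least `2 / π` times the distance, distances of `π κ / 2` mean `chord ≥ κ`,
and the inverse-square sum becomes `(π ^ 2 / 3) / κ ^ 2`, with `π ^ 2 / 3 < 3.29`. The sum of
squares costs one more factor `C / κ ^ 2`. -/
theorem tail_bounds {ι : Type*} {M : ℕ} (hM : 0 < M) (J : Finset ι) (ρ : ι → ℝ) {κ C : ℝ}
    (hκ : 0 < κ) (hC : 0 ≤ C) (g : ℝ → ℝ)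
    (hg : ∀ x, κ ≤ chord M x → |g x| ≤ C * (1 / chord M x ^ 2))
    (h0 : ∀ j ∈ J, |ρ j| ≤ Real.pi * M / 2)
    (h1 : ∀ j ∈ J, Real.pi / 2 * κ ≤ |ρ j|)
    (h2 : ∀ i ∈ J, ∀ j ∈ J, i ≠ j → Real.pi / 2 * κ ≤ |ρ i - ρ j|) :
    ∑ j ∈ J, |g (ρ j)| ≤ C * (329 / 100) / κ ^ 2 ∧
    ∑ j ∈ J, g (ρ j) ^ 2 ≤ C ^ 2 * (329 / 100) / κ ^ 4 := by
  have hpi := Real.pi_pos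
  have hb : 0 < Real.pi / 2 * κ := by positivity
  have hs := sum_inv_sq_le J ρ hb h1 h2
  have hch : ∀ j ∈ J, 2 / Real.pi * |ρ j| ≤ chord M (ρ j) := fun j hj =>
    two_div_pi_mul_abs_le_chord hM (h0 j hj)
  have hκ' : ∀ j ∈ J, κ ≤ chord M (ρ j) := fun j hj => by
    refine le_trans ?_ (hch j hj)
    calc κ = 2 / Real.pi * (Real.pi / 2 * κ) := by field_simp
      _ ≤ _ := by gcongr; exact h1 j hj
  have hsum : ∑ j ∈ J, 1 / chord M (ρ j) ^ 2 ≤ 329 / 100 / κ ^ 2 := by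
    calc ∑ j ∈ J, 1 / chord M (ρ j) ^ 2 ≤ ∑ j ∈ J, Real.pi ^ 2 / 4 * (1 / ρ j ^ 2) := by
          refine sum_le_sum fun j hj => ?_
          have hρ : 0 < |ρ j| := hb.trans_le (h1 j hj)
          calc 1 / chord M (ρ j) ^ 2 ≤ 1 / (2 / Real.pi * |ρ j|) ^ 2 := by
                have := hch j hj
                gcongr
            _ = _ := by rw [mul_pow, sq_abs, div_pow]; field_simp; norm_num
      _ ≤ Real.pi ^ 2 / 4 * (Real.pi ^ 2 / 3 / (Real.pi / 2 * κ) ^ 2) := by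
          rw [← mul_sum]; gcongr
      _ = Real.pi ^ 2 / 3 / κ ^ 2 := by field_simp; norm_num
      _ ≤ _ := by
          refine div_le_div_of_nonneg_right ?_ (by positivity)
          nlinarith [Real.pi_lt_d4]
  have hle : ∀ j ∈ J, |g (ρ j)| ≤ C * (1 / chord M (ρ j) ^ 2) := fun j hj => hg _ (hκ' j hj)
  constructor
  · calc ∑ j ∈ J, |g (ρ j)| ≤ C * ∑ j ∈ J, 1 / chord M (ρ j) ^ 2 := by
          rw [mul_sum]; exact sum_le_sum hle
      _ ≤ C * (329 / 100 / κ ^ 2) := by gcongr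
      _ = _ := by ring
  · calc ∑ j ∈ J, g (ρ j) ^ 2 ≤ ∑ j ∈ J, C ^ 2 * (1 / κ ^ 2) * (1 / chord M (ρ j) ^ 2) := by
          refine sum_le_sum fun j hj => ?_
          have h3 := hκ' j hj
          have h4 := hle j hj
          have h5 : 1 / chord M (ρ j) ^ 2 ≤ 1 / κ ^ 2 := by gcongr
          have h6 : 0 < chord M (ρ j) := hκ.trans_le h3
          rw [← sq_abs]
          calc |g (ρ j)| ^ 2 ≤ (C * (1 / chord M (ρ j) ^ 2)) ^ 2 := by gcongr
            _ = C ^ 2 * (1 / chord M (ρ j) ^ 2) * (1 / chord M (ρ j) ^ 2) := by ring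
            _ ≤ _ := by gcongr
      _ ≤ C ^ 2 * (1 / κ ^ 2) * (329 / 100 / κ ^ 2) := by
          rw [← mul_sum]; gcongr
      _ = _ := by field_simp

/-- The points `u j` have mutual distances at least `2.38 π` modulo `π M`. -/
def Separated (M : ℕ) {K : ℕ} (u : Fin K → ℝ) : Prop :=
  ∀ i j, i ≠ j → ∀ n : ℤ, 238 / 100 * Real.pi ≤ |u i - u j + n * (Real.pi * M)|

theorem exists_lift {M : ℕ} (hM : 0 < M) (x : ℝ) :
    ∃ (ρ : ℝ) (n : ℤ), x = ρ + n * (Real.pi * M) ∧ |ρ| ≤ Real.pi * M / 2 := by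
  have hp : 0 < Real.pi * M := by have := Real.pi_pos; positivity
  refine ⟨x - round (x / (Real.pi * M)) * (Real.pi * M), round (x / (Real.pi * M)), by ring, ?_⟩
  have := abs_sub_round (x / (Real.pi * M))
  calc |x - round (x / (Real.pi * M)) * (Real.pi * M)|
      = |x / (Real.pi * M) - round (x / (Real.pi * M))| * (Real.pi * M) := by
        rw [← abs_of_pos hp, ← abs_mul, abs_of_pos hp, sub_mul, div_mul_cancel₀ _ hp.ne']
    _ ≤ 1 / 2 * (Real.pi * M) := by gcongr
    _ = _ := by ring

section

variable {M K : ℕ} {u : Fin K → ℝ}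

theorem exists_lifts (hM : 0 < M) (hu : Separated M u) (v : ℝ) :
    ∃ (ρ : Fin K → ℝ) (n : Fin K → ℤ), (∀ j, v - u j = ρ j + n j * (Real.pi * M)) ∧
      (∀ j, |ρ j| ≤ Real.pi * M / 2) ∧
      ∀ i j, i ≠ j → 238 / 100 * Real.pi ≤ |ρ i - ρ j| := by
  choose ρ n h1 h2 using fun j => exists_lift hM (v - u j)
  refine ⟨ρ, n, h1, h2, fun i j hij => ?_⟩
  have := hu j i hij.symm (n j - n i)
  convert this using 2
  push_cast
  linarith [h1 i, h1 j]

theorem fejer_lift {ρ v : ℝ} {n : ℤ} {j : Fin K} (h : v - u j = ρ + n * (Real.pi * M)) :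
    fejer M (v - u j) = fejer M ρ ∧ fejer₁ M (v - u j) = fejer₁ M ρ ∧
      fejer₂ M (v - u j) = fejer₂ M ρ := by
  rw [h]
  exact ⟨fejer_add_int_mul .., fejer₁_add_int_mul .., fejer₂_add_int_mul ..⟩

theorem node_bounds (hM : 7 ≤ M) (hu : Separated M u) (k : Fin K) :
    ∑ j ∈ univ.erase k, |fejer M (u k - u j)| ≤ 14525 / 100000 ∧
    ∑ j ∈ univ.erase k, |fejer₁ M (u k - u j)| ≤ 2063 / 10000 ∧
    ∑ j ∈ univ.erase k, fejer₁ M (u k - u j) ^ 2 ≤ (1138 / 10000) ^ 2 := by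
  have hM0 : 0 < M := by omega
  have hpi := Real.pi_pos
  obtain ⟨ρ, n, h1, h2, h3⟩ := exists_lifts hM0 hu (u k)
  -- `4.76 = 2 * 2.38`: the full separation in units of `π / 2`.
  have hk : ∀ j ∈ univ.erase k, Real.pi / 2 * (476 / 100) ≤ |ρ j| := by
    intro j hj
    have := hu k j (ne_of_mem_erase hj).symm (-n j)
    rw [h1 j] at this
    push_cast at this
    rw [neg_mul, add_neg_cancel_right] at this
    linarith
  have hs : ∀ i ∈ univ.erase k, ∀ j ∈ univ.erase k, i ≠ j →
      Real.pi / 2 * (476 / 100) ≤ |ρ i - ρ j| := fun i _ j _ hij => by linarith [h3 i j hij]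
  have b0 := tail_bounds hM0 (univ.erase k) ρ (κ := 476 / 100) (C := 1) (by norm_num)
    (by norm_num) (fejer M) (fun x hx => by
      rw [abs_of_nonneg (fejer_nonneg M x), one_mul]
      exact fejer_le_inv_chord_sq hM0 (by linarith)) (fun j _ => h2 j) hk hs
  have b1 := tail_bounds hM0 (univ.erase k) ρ (κ := 476 / 100) (C := 1 + 2 / (476 / 100))
    (by norm_num) (by norm_num) (fejer₁ M)
    (fun x hx => abs_fejer₁_le_chord hM0 (by norm_num) hx) (fun j _ => h2 j) hk hs
  simp only [(fejer_lift (h1 _)).1, (fejer_lift (h1 _)).2.1]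
  exact ⟨b0.1.trans (by norm_num), b1.1.trans (by norm_num), b1.2.trans (by norm_num)⟩

theorem near_bounds (hM : 7 ≤ M) (hu : Separated M u) (k : Fin K) {t : ℝ} (ht : |t| ≤ 1) :
    ∑ j ∈ univ.erase k, fejer₁ M (u k + t - u j) ^ 2 ≤ (1591 / 10000) ^ 2 ∧
    ∑ j ∈ univ.erase k, fejer₂ M (u k + t - u j) ^ 2 ≤ (3805 / 10000) ^ 2 := by
  have hM0 : 0 < M := by omega
  have hpi := Real.pi_gt_d4
  obtain ⟨ρ, n, h1, h2, h3⟩ := exists_lifts hM0 hu (u k + t)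
  -- Moving by `|t| ≤ 1` leaves a distance of at least `2.38 π - 1 ≥ 2.06 π` to the other nodes.
  have hk : ∀ j ∈ univ.erase k, Real.pi / 2 * (412 / 100) ≤ |ρ j| := by
    intro j hj
    have h4 := hu k j (ne_of_mem_erase hj).symm (-n j)
    have h5 : u k - u j + ((-n j : ℤ) : ℝ) * (Real.pi * M) = ρ j - t := by
      push_cast; linarith [h1 j]
    rw [h5] at h4
    have := abs_sub (ρ j) t
    linarith
  have hs : ∀ i ∈ univ.erase k, ∀ j ∈ univ.erase k, i ≠ j →
      Real.pi / 2 * (412 / 100) ≤ |ρ i - ρ j| := fun i _ j _ hij => by linarith [h3 i j hij]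
  have b1 := tail_bounds hM0 (univ.erase k) ρ (κ := 412 / 100) (C := 1 + 2 / (412 / 100))
    (by norm_num) (by norm_num) (fejer₁ M)
    (fun x hx => abs_fejer₁_le_chord hM0 (by norm_num) hx) (fun j _ => h2 j) hk hs
  have b2 := tail_bounds hM0 (univ.erase k) ρ (κ := 412 / 100)
    (C := 2 + 4 / (412 / 100) + 10 / (412 / 100) ^ 2)
    (by norm_num) (by norm_num) (fejer₂ M)
    (fun x hx => abs_fejer₂_le_chord hM0 (by norm_num) hx) (fun j _ => h2 j) hk hs
  simp only [(fejer_lift (h1 _)).2.2, (fejer_lift (h1 _)).2.1]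
  exact ⟨b1.2.trans (by norm_num), b2.2.trans (by norm_num)⟩

theorem far_bounds (hM : 7 ≤ M) (hu : Separated M u) {v : ℝ}
    (hv : ∀ j, ∀ n : ℤ, 1 ≤ |v - u j + n * (Real.pi * M)|) :
    ∑ j, fejer M (v - u j) ^ 2 ≤ (7862 / 10000) ^ 2 ∧
    ∑ j, fejer₁ M (v - u j) ^ 2 ≤ (1021 / 1000) ^ 2 := by
  classical
  have hM0 : 0 < M := by omega
  have hpi := Real.pi_pos
  obtain ⟨ρ, n, h1, h2, h3⟩ := exists_lifts hM0 hu v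
  have h4 : ∀ j, 1 ≤ |ρ j| := fun j => by
    have := hv j (-n j)
    rw [h1 j] at this
    push_cast at this
    rwa [neg_mul, add_neg_cancel_right] at this
  simp only [(fejer_lift (h1 _)).1, (fejer_lift (h1 _)).2.1]
  -- The cutoff is half the separation, so at most one node is closer; that node is handled by the
  -- pointwise bounds `fejer_le_far` and `abs_fejer₁_le`.
  set J := univ.filter fun j => Real.pi / 2 * (238 / 100) ≤ |ρ j| with hJ
  have hk : ∀ j ∈ J, Real.pi / 2 * (238 / 100) ≤ |ρ j| := fun j hj => (mem_filter.1 hj).2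
  have hs : ∀ i ∈ J, ∀ j ∈ J, i ≠ j →
      Real.pi / 2 * (238 / 100) ≤ |ρ i - ρ j| := fun i _ j _ hij => by linarith [h3 i j hij]
  have b0 := (tail_bounds hM0 J ρ (κ := 238 / 100) (C := 1) (by norm_num)
    (by norm_num) (fejer M) (fun x hx => by
      rw [abs_of_nonneg (fejer_nonneg M x), one_mul]
      exact fejer_le_inv_chord_sq hM0 (by linarith)) (fun j _ => h2 j) hk hs).2
  have b1 := (tail_bounds hM0 J ρ (κ := 238 / 100) (C := 1 + 2 / (238 / 100))
    (by norm_num) (by norm_num) (fejer₁ M)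
    (fun x hx => abs_fejer₁_le_chord hM0 (by norm_num) hx) (fun j _ => h2 j) hk hs).2
  have hcard : Jᶜ.card ≤ 1 := by
    rw [card_le_one]
    intro i hi j hj
    by_contra hij
    simp only [hJ, mem_compl, mem_filter, mem_univ, true_and, not_le] at hi hj
    have := (abs_sub (ρ i) (ρ j))
    linarith [h3 i j hij]
  have hcard' : (Jᶜ.card : ℝ) ≤ 1 := by exact_mod_cast hcard
  have c0 : ∑ j ∈ Jᶜ, fejer M (ρ j) ^ 2 ≤ (718 / 1000) ^ 2 := by
    refine (sum_le_card_nsmul _ _ ((718 / 1000) ^ 2) fun j _ => ?_).trans ?_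
    · exact pow_le_pow_left₀ (fejer_nonneg _ _) (fejer_le_far hM (h4 j) (h2 j)) 2
    · rw [nsmul_eq_mul]; exact mul_le_of_le_one_left (by norm_num) hcard'
  have c1 : ∑ j ∈ Jᶜ, fejer₁ M (ρ j) ^ 2 ≤ (5 / 6) ^ 2 := by
    refine (sum_le_card_nsmul _ _ ((5 / 6) ^ 2) fun j _ => ?_).trans ?_
    · rw [← sq_abs]; exact pow_le_pow_left₀ (abs_nonneg _) (abs_fejer₁_le hM0 _) 2
    · rw [nsmul_eq_mul]; exact mul_le_of_le_one_left (by norm_num) hcard'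
  rw [← sum_add_sum_compl J, ← sum_add_sum_compl J]
  exact ⟨(add_le_add b0 c0).trans (by norm_num), (add_le_add b1 c1).trans (by norm_num)⟩

end

/-! ### Gram operators of the shifted kernels -/

/-- Schur test: Cauchy–Schwarz with weights `|A i j|` uses the row sums, then exchanging the sums
uses the column sums. -/
theorem norm_toEuclideanCLM_le {ι : Type*} [Fintype ι] [DecidableEq ι] (A : Matrix ι ι ℝ)
    {ε : ℝ} (hε : 0 ≤ ε) (hr : ∀ i, ∑ j, |A i j| ≤ ε) (hc : ∀ j, ∑ i, |A i j| ≤ ε) :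
    ‖Matrix.toEuclideanCLM (n := ι) (𝕜 := ℝ) A‖ ≤ ε := by
  refine ContinuousLinearMap.opNorm_le_bound _ hε fun v => ?_
  refine le_of_sq_le_sq ?_ (by positivity)
  rw [mul_pow, EuclideanSpace.real_norm_sq_eq, EuclideanSpace.real_norm_sq_eq]
  have h1 : ∀ i, (Matrix.toEuclideanCLM (n := ι) (𝕜 := ℝ) A v) i ^ 2 ≤
      ε * ∑ j, |A i j| * v j ^ 2 := by
    intro i
    have e : (Matrix.toEuclideanCLM (n := ι) (𝕜 := ℝ) A v) i = ∑ j, A i j * v j := by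
      rw [Matrix.ofLp_toEuclideanCLM]; rfl
    rw [e]
    calc (∑ j, A i j * v j) ^ 2 ≤ (∑ j, |A i j|) * ∑ j, |A i j| * v j ^ 2 := by
          refine sum_sq_le_sum_mul_sum_of_sq_le_mul _ (fun j _ => abs_nonneg _)
            (fun j _ => by positivity) fun j _ => ?_
          exact le_of_eq (by rw [mul_pow, ← sq_abs (A i j)]; ring)
      _ ≤ _ := by
          have : 0 ≤ ∑ j, |A i j| * v j ^ 2 := sum_nonneg fun j _ => by positivity
          exact mul_le_mul_of_nonneg_right (hr i) this
  calc _ ≤ ∑ i, ε * ∑ j, |A i j| * v j ^ 2 := sum_le_sum fun i _ => h1 i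
    _ = ε * ∑ j, (∑ i, |A i j|) * v j ^ 2 := by
        rw [← mul_sum, sum_comm]
        simp only [sum_mul]
    _ ≤ ε * ∑ j, ε * v j ^ 2 := by
        gcongr with j _
        exact hc j
    _ = _ := by rw [← mul_sum]; ring

/-- The vector of the values `g (v - u j)`. -/
noncomputable def shiftVec {K : ℕ} (u : Fin K → ℝ) (g : ℝ → ℝ) (v : ℝ) :
    EuclideanSpace ℝ (Fin K) :=
  WithLp.toLp 2 fun j => g (v - u j)

section

variable {M K : ℕ} {u : Fin K → ℝ}

theorem shiftVec_apply (g : ℝ → ℝ) (v : ℝ) (j : Fin K) : shiftVec u g v j = g (v - u j) := rfl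

theorem hasDerivAt_shiftVec {g g' : ℝ → ℝ} (h : ∀ x, HasDerivAt g (g' x) x) (v : ℝ) :
    HasDerivAt (shiftVec u g) (shiftVec u g' v) v := by
  have h1 : HasDerivAt (fun v => fun j => g (v - u j)) (fun j => g' (v - u j)) v :=
    hasDerivAt_pi.2 fun j => (h (v - u j)).comp_sub_const v (u j)
  exact (PiLp.continuousLinearEquiv 2 ℝ (fun _ : Fin K => ℝ)).symm.hasFDerivAt.comp_hasDerivAt v h1

theorem norm_shiftVec_sq (g : ℝ → ℝ) (v : ℝ) :
    ‖shiftVec u g v‖ ^ 2 = ∑ j, g (v - u j) ^ 2 := by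
  rw [EuclideanSpace.real_norm_sq_eq]; rfl

theorem norm_shiftVec_sq_eq_add (g : ℝ → ℝ) (v : ℝ) (k : Fin K) :
    ‖shiftVec u g v‖ ^ 2 = g (v - u k) ^ 2 + ∑ j ∈ univ.erase k, g (v - u j) ^ 2 := by
  rw [norm_shiftVec_sq, add_sum_erase univ (fun j => g (v - u j) ^ 2) (mem_univ k)]

theorem norm_shiftVec_sub_single_sq (g : ℝ → ℝ) (v : ℝ) (k : Fin K) :
    ‖shiftVec u g v - g (v - u k) • EuclideanSpace.single k 1‖ ^ 2 =
      ∑ j ∈ univ.erase k, g (v - u j) ^ 2 := by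
  rw [EuclideanSpace.real_norm_sq_eq, ← add_sum_erase _ _ (mem_univ k)]
  simp only [PiLp.sub_apply, shiftVec_apply, PiLp.smul_apply, PiLp.single_apply, smul_eq_mul]
  simp only [if_true, mul_one, sub_self]
  rw [zero_pow two_ne_zero, zero_add]
  refine sum_congr rfl fun j hj => ?_
  simp [ne_of_mem_erase hj]

/-- The Gram matrix has unit diagonal and small off-diagonal row sums, so a Neumann series inverts
it; `1 / (1 - 0.14525) < 1.17` gives both bounds. -/
theorem exists_inverse_gram (hM : 7 ≤ M) (hu : Separated M u) :
    ∃ A : EuclideanSpace ℝ (Fin K) →L[ℝ] EuclideanSpace ℝ (Fin K),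
      (∀ k, A (shiftVec u (fejer M) (u k)) = EuclideanSpace.single k 1) ∧
      ‖A‖ ≤ 117 / 100 ∧ ‖A - 1‖ ≤ 17 / 100 := by
  let B : Matrix (Fin K) (Fin K) ℝ := Matrix.of fun i j => fejer M (u i - u j)
  let G := Matrix.toEuclideanCLM (n := Fin K) (𝕜 := ℝ) B
  have hdiff : ∀ i, ∑ j, |(1 - B) i j| ≤ 14525 / 100000 := by
    intro i
    rw [← add_sum_erase _ _ (mem_univ i)]
    have h1 : |(1 - B) i i| = 0 := by simp [B, fejer_zero (by omega : 0 < M)]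
    rw [h1, zero_add]
    refine le_trans (le_of_eq (sum_congr rfl fun j hj => ?_)) (node_bounds hM hu i).1
    simp [B, Matrix.one_apply_ne (ne_of_mem_erase hj).symm]
  have hsymm : ∀ i j, (1 - B) i j = (1 - B) j i := by
    intro i j
    have : fejer M (u i - u j) = fejer M (u j - u i) := by rw [← fejer_neg, neg_sub]
    simp [B, Matrix.one_apply, eq_comm, this]
  have hG : ‖1 - G‖ ≤ 14525 / 100000 := by
    have : 1 - G = Matrix.toEuclideanCLM (n := Fin K) (𝕜 := ℝ) (1 - B) := by
      simp [G]
    rw [this]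
    refine norm_toEuclideanCLM_le _ (by norm_num) hdiff fun j => ?_
    simpa only [hsymm _ j] using hdiff j
  have hlt : ‖1 - G‖ < 1 := hG.trans_lt (by norm_num)
  let U := Units.oneSub (1 - G) hlt
  have hUG : (U : EuclideanSpace ℝ (Fin K) →L[ℝ] EuclideanSpace ℝ (Fin K)) = G := by
    simp [U]
  let A : EuclideanSpace ℝ (Fin K) →L[ℝ] EuclideanSpace ℝ (Fin K) := ↑U⁻¹
  have hAG : A * G = 1 := by rw [← hUG]; exact U.inv_mul
  have hA1 : A - 1 = A * (1 - G) := by rw [mul_sub, hAG, mul_one]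
  have hA2 : ‖A - 1‖ ≤ ‖A‖ * (14525 / 100000) := by
    rw [hA1]
    exact (norm_mul_le _ _).trans (by gcongr)
  have hA : ‖A‖ ≤ 117 / 100 := by
    have h1 : ‖A‖ ≤ ‖A - 1‖ + ‖(1 : EuclideanSpace ℝ (Fin K) →L[ℝ] EuclideanSpace ℝ (Fin K))‖ := by
      simpa using norm_add_le (A - 1) 1
    have h2 : ‖(1 : EuclideanSpace ℝ (Fin K) →L[ℝ] EuclideanSpace ℝ (Fin K))‖ ≤ 1 :=
      ContinuousLinearMap.norm_id_le
    linarith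
  refine ⟨A, fun k => ?_, hA, by linarith⟩
  have h1 : shiftVec u (fejer M) (u k) = G (EuclideanSpace.single k 1) := by
    ext j
    have e : (G (EuclideanSpace.single k (1 : ℝ))) j = B j k := by
      simp [G, Matrix.ofLp_toEuclideanCLM]
    rw [e, shiftVec_apply, ← fejer_neg, neg_sub]
    rfl
  rw [h1]
  exact congrArg (fun T => T (EuclideanSpace.single k 1)) hAG

/-- The matrix is antisymmetric because `fejer₁` is odd, so row and column sums agree. The bound on
one coordinate is Cauchy–Schwarz against a single row and is sharper than the operator norm. -/
theorem exists_derivative_gram (hM : 7 ≤ M) (hu : Separated M u) :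
    ∃ H : EuclideanSpace ℝ (Fin K) →L[ℝ] EuclideanSpace ℝ (Fin K),
      (∀ k, H (EuclideanSpace.single k 1) = shiftVec u (fejer₁ M) (u k)) ∧
      ‖H‖ ≤ 2063 / 10000 ∧ ∀ x k, |H x k| ≤ 1138 / 10000 * ‖x‖ := by
  let B : Matrix (Fin K) (Fin K) ℝ := Matrix.of fun i j => fejer₁ M (u j - u i)
  let H := Matrix.toEuclideanCLM (n := Fin K) (𝕜 := ℝ) B
  have hcol : ∀ j, ∑ i, |B i j| ≤ 2063 / 10000 := by
    intro j
    rw [← add_sum_erase _ _ (mem_univ j)]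
    have h1 : |B j j| = 0 := by simp [B, fejer₁_zero]
    rw [h1, zero_add]
    exact (node_bounds hM hu j).2.1
  have hsymm : ∀ i j, |B i j| = |B j i| := by
    intro i j
    have : fejer₁ M (u j - u i) = -fejer₁ M (u i - u j) := by rw [← fejer₁_neg, neg_sub]
    simp [B, this]
  refine ⟨H, fun k => ?_, norm_toEuclideanCLM_le _ (by norm_num) (fun i => ?_) hcol,
    fun x k => ?_⟩
  · ext j
    simp [H, Matrix.ofLp_toEuclideanCLM, shiftVec_apply, B]
  · simpa only [hsymm i] using hcol i
  · have e : H x k = ∑ j, B k j * x j := by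
      simp only [H, Matrix.ofLp_toEuclideanCLM]; rfl
    refine abs_le_of_sq_le_sq ?_ (by positivity)
    rw [e, mul_pow, EuclideanSpace.real_norm_sq_eq]
    refine (sum_mul_sq_le_sq_mul_sq _ _ _).trans ?_
    gcongr
    rw [← add_sum_erase _ _ (mem_univ k)]
    have h1 : B k k ^ 2 = 0 := by simp [B, fejer₁_zero]
    rw [h1, zero_add]
    refine le_trans (le_of_eq (sum_congr rfl fun j _ => ?_)) (node_bounds hM hu k).2.2
    rw [← sq_abs, hsymm k j, sq_abs]
    rfl

theorem norm_fejer₁Vec_node_le (hM : 7 ≤ M) (hu : Separated M u) (k : Fin K) :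
    ‖shiftVec u (fejer₁ M) (u k)‖ ≤ 1138 / 10000 := by
  refine le_of_sq_le_sq ?_ (by norm_num)
  rw [norm_shiftVec_sq_eq_add _ _ k, sub_self, fejer₁_zero, zero_pow two_ne_zero, zero_add]
  exact (node_bounds hM hu k).2.2

theorem abs_coord_le (x : EuclideanSpace ℝ (Fin K)) (k : Fin K) : |x k| ≤ ‖x‖ := by
  simpa using PiLp.norm_apply_le x k

/-- The operators of the interpolating curve `A f - B (f' - H A f)`, where `f` is the vector of
shifted Fejér kernels: `A` makes it pass through the `k`-th basis vector at `u k`, and `B` makes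
its velocity there orthogonal to that vector. -/
theorem exists_curve_operators (hM : 7 ≤ M) (hu : Separated M u) :
    ∃ A H B : EuclideanSpace ℝ (Fin K) →L[ℝ] EuclideanSpace ℝ (Fin K), ∃ β : Fin K → ℝ,
      (∀ x k, B x k = β k * x k) ∧
      (∀ k, A (shiftVec u (fejer M) (u k)) = EuclideanSpace.single k 1) ∧
      (∀ k, H (EuclideanSpace.single k 1) = shiftVec u (fejer₁ M) (u k)) ∧
      ‖A‖ ≤ 117 / 100 ∧ ‖A - 1‖ ≤ 17 / 100 ∧ ‖H‖ ≤ 2063 / 10000 ∧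
      (∀ x k, |H x k| ≤ 1138 / 10000 * ‖x‖) ∧ ‖B‖ ≤ 304 / 10000 ∧
      (∀ k, |β k| ≤ 304 / 10000) ∧
      ∀ k, A (shiftVec u (fejer₁ M) (u k)) k =
        β k * (fejer₂ M 0 - H (A (shiftVec u (fejer₁ M) (u k))) k) := by
  obtain ⟨A, hA, hA1, hA2⟩ := exists_inverse_gram hM hu
  obtain ⟨H, hH, hH1, hH2⟩ := exists_derivative_gram hM hu
  let c : Fin K → ℝ := fun k => A (shiftVec u (fejer₁ M) (u k)) k
  let η : Fin K → ℝ := fun k => fejer₂ M 0 - H (A (shiftVec u (fejer₁ M) (u k))) k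
  -- The `k`-th coordinate of `f'` at the `k`-th node is `fejer₁ M 0 = 0`, so `A` may be replaced by
  -- the small operator `A - 1`.
  have hc : ∀ k, |c k| ≤ 17 / 100 * (1138 / 10000) := fun k => by
    have h0 : shiftVec u (fejer₁ M) (u k) k = 0 := by simp [shiftVec_apply, fejer₁_zero]
    have e : c k = (A - 1) (shiftVec u (fejer₁ M) (u k)) k := by
      simp [c, h0]
    rw [e]
    refine (abs_coord_le _ _).trans (((A - 1).le_opNorm _).trans ?_)
    gcongr
    exact norm_fejer₁Vec_node_le hM hu k
  have hη : ∀ k, η k ≤ -(6378 / 10000) := fun k => by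
    have h1 := hH2 (A (shiftVec u (fejer₁ M) (u k))) k
    have h2 : ‖A (shiftVec u (fejer₁ M) (u k))‖ ≤ 117 / 100 * (1138 / 10000) := by
      refine (A.le_opNorm _).trans ?_
      gcongr
      exact norm_fejer₁Vec_node_le hM hu k
    have h3 := fejer₂_zero_le hM
    have h4 := (abs_le.1 h1).1
    simp only [η]
    linarith
  have hβ : ∀ k, |c k / η k| ≤ 304 / 10000 := fun k => by
    have h1 := hη k
    have h2 := hc k
    rw [abs_div, abs_of_neg (by linarith : η k < 0), div_le_iff₀ (by linarith)]
    linarith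
  -- The quotient `c k / η k` is the solution of the linear equation that makes the `k`-th component
  -- of the velocity at the `k`-th node vanish; `η k` stays away from zero because `fejer₂ M 0` is
  -- near `-2 / 3`.
  let B := Matrix.toEuclideanCLM (n := Fin K) (𝕜 := ℝ) (Matrix.diagonal fun k => c k / η k)
  refine ⟨A, H, B, fun k => c k / η k, fun x k => ?_, hA, hH, hA1, hA2, hH1, hH2, ?_, hβ,
    fun k => ?_⟩
  · simp [B, Matrix.ofLp_toEuclideanCLM, Matrix.mulVec_diagonal]
  · refine norm_toEuclideanCLM_le _ (by norm_num) (fun i => ?_) fun j => ?_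
    · rw [sum_eq_single i (fun j _ hj => by simp [Matrix.diagonal_apply_ne _ hj.symm]) (by simp)]
      simpa using hβ i
    · rw [sum_eq_single j (fun i _ hi => by simp [Matrix.diagonal_apply_ne _ hi]) (by simp)]
      simpa using hβ j
  · have := hη k
    exact (div_mul_cancel₀ (c k) (by linarith : η k < 0).ne).symm

end

/-! ### The interpolating curve stays in the unit ball -/

section

variable {M K : ℕ} {u : Fin K → ℝ}

theorem norm_vec_near_le (hM : 7 ≤ M) (hu : Separated M u) (k : Fin K) {t : ℝ} (ht : |t| ≤ 1) :
    ‖shiftVec u (fejer₁ M) (u k + t)‖ ≤ 6855 / 10000 ∧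
    ‖shiftVec u (fejer₂ M) (u k + t)‖ ≤ 7677 / 10000 ∧
    ‖shiftVec u (fejer₁ M) (u k + t) - fejer₁ M t • EuclideanSpace.single k 1‖ ≤
      1591 / 10000 := by
  obtain ⟨h1, h2⟩ := near_bounds hM hu k ht
  have hM0 : 0 < M := by omega
  have e : u k + t - u k = t := by ring
  refine ⟨le_of_sq_le_sq ?_ (by norm_num), le_of_sq_le_sq ?_ (by norm_num),
    le_of_sq_le_sq ?_ (by norm_num)⟩
  · rw [norm_shiftVec_sq_eq_add _ _ k, e]
    have h3 : fejer₁ M t ^ 2 ≤ (2 / 3) ^ 2 := by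
      rw [← sq_abs]
      refine pow_le_pow_left₀ (abs_nonneg _) ((abs_fejer₁_le_mul hM0 t).trans ?_) 2
      linarith
    exact (add_le_add h3 h1).trans (by norm_num)
  · rw [norm_shiftVec_sq_eq_add _ _ k, e]
    have h3 : fejer₂ M t ^ 2 ≤ (2 / 3) ^ 2 := by
      rw [← sq_abs]
      exact pow_le_pow_left₀ (abs_nonneg _) (abs_fejer₂_le hM0 t) 2
    exact (add_le_add h3 h2).trans (by norm_num)
  · have := norm_shiftVec_sub_single_sq (u := u) (fejer₁ M) (u k + t) k
    rw [e] at this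
    rw [this]
    exact h1

theorem norm_le_mul_abs_of_deriv {E : Type*} [NormedAddCommGroup E] [NormedSpace ℝ E]
    {r r' : ℝ → E} {C a : ℝ} (h0 : r 0 = 0) (hr : ∀ t, HasDerivAt r (r' t) t)
    (hb : ∀ t, |t| ≤ a → ‖r' t‖ ≤ C) {t : ℝ} (ht : |t| ≤ a) : ‖r t‖ ≤ C * |t| := by
  have ha : 0 ≤ a := (abs_nonneg t).trans ht
  have := (convex_Icc (-a) a).norm_image_sub_le_of_norm_hasDerivWithin_le
    (f := r) (f' := r') (C := C) (x := 0) (y := t)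
    (fun x _ => (hr x).hasDerivWithinAt) (fun x hx => hb x (abs_le.2 hx))
    ⟨by linarith, ha⟩ (abs_le.1 ht)
  simpa [h0] using this

/-- Fejér-type interpolation at separated nodes: there are combinations `P k` of shifted Fejér
kernels and their derivatives, with `P k (u j) = δ k j`, whose sum of squares is less than `1`
off the nodes. -/
theorem exists_interpolating_curve (hM : 7 ≤ M) (hu : Separated M u) :
    ∃ a b : Fin K → Fin K → ℝ,
      (∀ k i, ∑ j, (a k j * fejer M (u i - u j) + b k j * fejer₁ M (u i - u j)) =
        if k = i then 1 else 0) ∧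
      ∀ v, (∀ j, ∀ n : ℤ, v ≠ u j + n * (Real.pi * M)) →
        ∑ k, (∑ j, (a k j * fejer M (v - u j) + b k j * fejer₁ M (v - u j))) ^ 2 < 1 := by
  classical
  have hM0 : 0 < M := by omega
  obtain ⟨A, H, B, β, hB, hA, hH, hA1, hA2, hH1, hH2, hB1, hβ, hder⟩ :=
    exists_curve_operators hM hu
  let f := shiftVec u (fejer M)
  let f₁ := shiftVec u (fejer₁ M)
  let f₂ := shiftVec u (fejer₂ M)
  let P : ℝ → EuclideanSpace ℝ (Fin K) := fun v => A (f v) - B (f₁ v - H (A (f v)))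
  have hdf : ∀ v, HasDerivAt f (f₁ v) v := hasDerivAt_shiftVec (hasDerivAt_fejer M)
  have hdf₁ : ∀ v, HasDerivAt f₁ (f₂ v) v := hasDerivAt_shiftVec (hasDerivAt_fejer₁ M)
  have hPnode : ∀ k, P (u k) = EuclideanSpace.single k 1 := fun k => by
    simp only [P, f, f₁, hA, hH, sub_self, map_zero, sub_zero]
  have hPeq : ∀ v k, P v k = ∑ j, ((A (EuclideanSpace.single j 1) +
      B (H (A (EuclideanSpace.single j 1)))) k * fejer M (v - u j) +
      (if k = j then -β k else 0) * fejer₁ M (v - u j)) := by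
    intro v k
    have h1 : f v = ∑ j, fejer M (v - u j) • EuclideanSpace.single j (1 : ℝ) := by
      ext i
      simp [f, shiftVec_apply, Finset.sum_apply, Pi.single_apply]
    have h2 : P v k = (A (f v) + B (H (A (f v)))) k - β k * fejer₁ M (v - u k) := by
      simp only [P, map_sub, PiLp.sub_apply, PiLp.add_apply, hB _ k, f₁, shiftVec_apply]
      ring
    rw [h2, h1]
    simp only [map_sum, map_smul, ite_mul, zero_mul, ← sum_add_distrib, ← smul_add]
    rw [sum_add_distrib, sum_ite_eq, if_pos (mem_univ k), WithLp.ofLp_sum, Finset.sum_apply]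
    simp only [WithLp.ofLp_smul, Pi.smul_apply, smul_eq_mul, mul_comm]
    ring
  refine ⟨fun k j => (A (EuclideanSpace.single j 1) + B (H (A (EuclideanSpace.single j 1)))) k,
    fun k j => if k = j then -β k else 0, fun k i => ?_, fun v hv => ?_⟩
  · rw [← hPeq, hPnode, PiLp.single_apply]
  simp only [← hPeq]
  rw [← EuclideanSpace.real_norm_sq_eq]
  by_cases hfar : ∀ j, ∀ n : ℤ, 1 ≤ |v - u j + n * (Real.pi * M)|
  · obtain ⟨b0, b1⟩ := far_bounds hM hu hfar
    have c0 : ‖f v‖ ≤ 7862 / 10000 := le_of_sq_le_sq (by rwa [norm_shiftVec_sq]) (by norm_num)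
    have c1 : ‖f₁ v‖ ≤ 1021 / 1000 := le_of_sq_le_sq (by rwa [norm_shiftVec_sq]) (by norm_num)
    have d0 : ‖A (f v)‖ ≤ 117 / 100 * (7862 / 10000) := (A.le_opNorm _).trans (by gcongr)
    have d1 : ‖H (A (f v))‖ ≤ 2063 / 10000 * (117 / 100 * (7862 / 10000)) :=
      (H.le_opNorm _).trans (by gcongr)
    have d2 : ‖f₁ v - H (A (f v))‖ ≤
        1021 / 1000 + 2063 / 10000 * (117 / 100 * (7862 / 10000)) :=
      (norm_sub_le _ _).trans (add_le_add c1 d1)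
    have d3 : ‖B (f₁ v - H (A (f v)))‖ ≤ 304 / 10000 *
        (1021 / 1000 + 2063 / 10000 * (117 / 100 * (7862 / 10000))) :=
      (B.le_opNorm _).trans (by gcongr)
    have d4 : ‖P v‖ ≤ 96 / 100 := by
      refine (norm_sub_le _ _).trans ((add_le_add d0 d3).trans ?_)
      norm_num
    nlinarith [norm_nonneg (P v)]
  · push Not at hfar
    obtain ⟨k, n, hn⟩ := hfar
    set t := v - u k + n * (Real.pi * M) with htdef
    have ht0 : t ≠ 0 := fun h => hv k (-n) (by push_cast; linarith)
    -- Periodicity allows the nearby node to be taken as `u k` itself.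
    have hPt : P v = P (u k + t) := by
      ext i
      rw [hPeq, hPeq]
      refine sum_congr rfl fun j _ => ?_
      have e : u k + t - u j = v - u j + n * (Real.pi * M) := by rw [htdef]; ring
      rw [e, fejer_add_int_mul, fejer₁_add_int_mul]
    rw [hPt]
    let P₁ : ℝ → EuclideanSpace ℝ (Fin K) := fun v => A (f₁ v) - B (f₂ v - H (A (f₁ v)))
    have hdP : ∀ v, HasDerivAt P (P₁ v) v := fun v =>
      (A.hasFDerivAt.comp_hasDerivAt v (hdf v)).sub
        (B.hasFDerivAt.comp_hasDerivAt v ((hdf₁ v).sub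
          (H.hasFDerivAt.comp_hasDerivAt v (A.hasFDerivAt.comp_hasDerivAt v (hdf v)))))
    let e : EuclideanSpace ℝ (Fin K) := EuclideanSpace.single k 1
    have he : ‖e‖ = 1 := by simp [e]
    -- The remainder after the leading term `fejer M t • e`: bounded linearly in `t` by one
    -- derivative, and along `e` quadratically by two.
    let r : ℝ → EuclideanSpace ℝ (Fin K) := fun t => P (u k + t) - fejer M t • e
    let r₁ : ℝ → EuclideanSpace ℝ (Fin K) := fun t => P₁ (u k + t) - fejer₁ M t • e
    have hr0 : r 0 = 0 := by simp [r, e, hPnode, fejer_zero hM0]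
    have hdr : ∀ t, HasDerivAt r (r₁ t) t := fun t =>
      ((hdP (u k + t)).comp_const_add (u k) t).sub ((hasDerivAt_fejer M t).smul_const e)
    have hr₁ : ∀ t, |t| ≤ 1 → ‖r₁ t‖ ≤ 3041 / 10000 := by
      intro t ht
      obtain ⟨b1, b2, b3⟩ := norm_vec_near_le hM hu k ht
      have e1 : r₁ t = (A - 1) (f₁ (u k + t)) + (f₁ (u k + t) - fejer₁ M t • e) -
          B (f₂ (u k + t) - H (A (f₁ (u k + t)))) := by
        simp only [r₁, P₁, sub_apply, one_apply_eq_self]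
        abel
      have d1 : ‖(A - 1) (f₁ (u k + t))‖ ≤ 17 / 100 * (6855 / 10000) :=
        ((A - 1).le_opNorm _).trans (by gcongr)
      have d2 : ‖A (f₁ (u k + t))‖ ≤ 117 / 100 * (6855 / 10000) :=
        (A.le_opNorm _).trans (by gcongr)
      have d3 : ‖H (A (f₁ (u k + t)))‖ ≤ 2063 / 10000 * (117 / 100 * (6855 / 10000)) :=
        (H.le_opNorm _).trans (by gcongr)
      have d4 := (norm_sub_le _ _).trans (add_le_add b2 d3)
      have d5 := (B.le_opNorm _).trans (mul_le_mul hB1 d4 (norm_nonneg _) (by norm_num))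
      rw [e1]
      refine (norm_sub_le _ _).trans ((add_le_add ((norm_add_le _ _).trans
        (add_le_add d1 b3)) d5).trans ?_)
      norm_num
    have hr : ‖r t‖ ≤ 3041 / 10000 * |t| := norm_le_mul_abs_of_deriv hr0 hdr hr₁ hn.le
    let s₁ : ℝ → ℝ := fun t => r₁ t k
    let s₂ : ℝ → ℝ := fun t => (A (f₂ (u k + t))) k -
      β k * (fejer₃ M t - H (A (f₂ (u k + t))) k) - fejer₂ M t
    have hs₁eq : ∀ t, s₁ t = (A (f₁ (u k + t))) k -
        β k * (fejer₂ M t - H (A (f₁ (u k + t))) k) - fejer₁ M t := by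
      intro t
      have e1 : u k + t - u k = t := by ring
      simp only [s₁, r₁, P₁, PiLp.sub_apply, hB _ k, PiLp.smul_apply, e, PiLp.single_apply, f₂,
        shiftVec_apply, e1]
      simp
    -- This is where the choice of `β k` enters: the velocity at the node has no component along
    -- `e`.
    have hs₁0 : s₁ 0 = 0 := by
      rw [hs₁eq, add_zero, fejer₁_zero]
      simp only [f₁]
      rw [hder k]
      ring
    let π' := (EuclideanSpace.proj k : EuclideanSpace ℝ (Fin K) →L[ℝ] ℝ)
    have hdf₁' : ∀ t, HasDerivAt (fun t => f₁ (u k + t)) (f₂ (u k + t)) t := fun t =>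
      (hdf₁ (u k + t)).comp_const_add (u k) t
    have hds : ∀ t, HasDerivAt s₁ (s₂ t) t := by
      intro t
      have h1 : HasDerivAt (fun t => A (f₁ (u k + t)) k) (A (f₂ (u k + t)) k) t :=
        (π'.comp A).hasFDerivAt.comp_hasDerivAt t (hdf₁' t)
      have h2 : HasDerivAt (fun t => H (A (f₁ (u k + t))) k) (H (A (f₂ (u k + t))) k) t :=
        (π'.comp (H.comp A)).hasFDerivAt.comp_hasDerivAt t (hdf₁' t)
      rw [funext hs₁eq]
      exact (h1.fun_sub (((hasDerivAt_fejer₂ M t).fun_sub h2).const_mul (β k))).fun_sub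
        (hasDerivAt_fejer₁ M t)
    have hs₂ : ∀ t, |t| ≤ 1 → ‖s₂ t‖ ≤ 1742 / 10000 := by
      intro t ht
      obtain ⟨-, b2, -⟩ := norm_vec_near_le hM hu k ht
      have e1 : u k + t - u k = t := by ring
      have e2 : s₂ t = (A - 1) (f₂ (u k + t)) k -
          β k * (fejer₃ M t - H (A (f₂ (u k + t))) k) := by
        have : f₂ (u k + t) k = fejer₂ M t := by simp only [f₂, shiftVec_apply, e1]
        simp only [s₂, sub_apply, one_apply_eq_self,
          PiLp.sub_apply, this]
        ring
      have d1 : |(A - 1) (f₂ (u k + t)) k| ≤ 17 / 100 * (7677 / 10000) :=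
        (abs_coord_le _ _).trans (((A - 1).le_opNorm _).trans (by gcongr))
      have d2 : ‖A (f₂ (u k + t))‖ ≤ 117 / 100 * (7677 / 10000) :=
        (A.le_opNorm _).trans (by gcongr)
      have d3 : |H (A (f₂ (u k + t))) k| ≤ 1138 / 10000 * (117 / 100 * (7677 / 10000)) :=
        (hH2 _ _).trans (by gcongr)
      have d4 := (abs_sub _ _).trans (add_le_add (abs_fejer₃_le hM0 t) d3)
      rw [Real.norm_eq_abs, e2]
      have d5 : |β k * (fejer₃ M t - H (A (f₂ (u k + t))) k)| ≤ 304 / 10000 *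
          (4 / 3 + 1138 / 10000 * (117 / 100 * (7677 / 10000))) := by
        rw [abs_mul]
        exact mul_le_mul (hβ k) d4 (abs_nonneg _) (by norm_num)
      exact (abs_sub _ _).trans ((add_le_add d1 d5).trans (by norm_num))
    have hs₁ : ∀ x, |x| ≤ |t| → ‖s₁ x‖ ≤ 1742 / 10000 * |t| := fun x hx =>
      (norm_le_mul_abs_of_deriv hs₁0 hds hs₂ (hx.trans hn.le)).trans (by gcongr)
    have hrk : ‖r t k‖ ≤ 1742 / 10000 * |t| * |t| :=
      norm_le_mul_abs_of_deriv (r := fun t => r t k) (by simp [hr0])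
        (fun x => π'.hasFDerivAt.comp_hasDerivAt x (hdr x)) hs₁ le_rfl
    have hsplit : P (u k + t) = fejer M t • e + r t := by simp [r]
    have hin : inner ℝ e (r t) = r t k := by
      simp [e, EuclideanSpace.inner_single_left]
    -- Now `‖P‖ ^ 2 = F ^ 2 + 2 F r_k + ‖r‖ ^ 2`, and the bound is strict since `2 * 0.1742 + 0.3041
    -- ^ 2 < 0.48`.
    rw [hsplit, norm_add_sq_real, norm_smul, he, mul_one, inner_smul_left, hin,
      Real.norm_eq_abs, sq_abs]
    have hF := fejer_sq_le_near hM hn.le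
    have hF0 := fejer_nonneg M t
    have hF1 : fejer M t ≤ 1 := by nlinarith [sq_nonneg t]
    rw [Real.norm_eq_abs, mul_assoc, ← sq, sq_abs] at hrk
    have hr2 : ‖r t‖ ^ 2 ≤ (3041 / 10000) ^ 2 * t ^ 2 := by
      rw [← sq_abs t, ← mul_pow]
      exact pow_le_pow_left₀ (norm_nonneg _) hr 2
    have hx : fejer M t * r t k ≤ 1742 / 10000 * t ^ 2 := by
      nlinarith [mul_le_mul_of_nonneg_left (le_abs_self (r t k)) hF0, abs_nonneg (r t k)]
    have ht2 : 0 < t ^ 2 := by positivity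
    simp only [conj_trivial]
    linarith

end

/-! ### From kernels to polynomials in the array response -/

/-- The functions of the angle that become polynomials of degree less than `N` in
`z = exp (2 π i sin φ)` after multiplication by `z ^ d`. -/
def trigSpan (N d : ℕ) : Submodule ℂ (ℝ → ℂ) where
  carrier := {g | ∃ q : Fin N → ℂ, ∀ φ, q ⬝ᵥ arrayResponse N φ =
    Complex.exp (2 * Real.pi * Complex.I * (Real.sin φ : ℂ) * (d : ℂ)) * g φ}
  add_mem' := by
    rintro f g ⟨p, hp⟩ ⟨q, hq⟩
    exact ⟨p + q, fun φ => by rw [add_dotProduct, hp, hq, Pi.add_apply, mul_add]⟩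
  zero_mem' := ⟨0, fun φ => by simp⟩
  smul_mem' := by
    rintro c f ⟨p, hp⟩
    exact ⟨c • p, fun φ => by
      rw [smul_dotProduct, hp, Pi.smul_apply, smul_eq_mul, smul_eq_mul]; ring⟩

theorem exp_mem_trigSpan {N d : ℕ} (hN : 2 * d < N) {n : ℤ} (hn : |n| ≤ d) :
    (fun φ : ℝ => Complex.exp (2 * Real.pi * Complex.I * (Real.sin φ : ℂ) * (n : ℂ))) ∈
      trigSpan N d := by
  obtain ⟨h1, h2⟩ := abs_le.1 hn
  have hlt : (n + d).toNat < N := by omega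
  refine ⟨Pi.single ⟨(n + d).toNat, hlt⟩ 1, fun φ => ?_⟩
  rw [single_one_dotProduct, arrayResponse, ← Complex.exp_add]
  congr 1
  have h3 : (((n + d).toNat : ℕ) : ℂ) = (n : ℂ) + d := by
    have : (((n + d).toNat : ℕ) : ℤ) = n + d := Int.toNat_of_nonneg (by omega)
    exact_mod_cast congrArg (Int.cast : ℤ → ℂ) this
  simp only [h3]
  ring

theorem exp_shift_mem_trigSpan {N d : ℕ} (hN : 2 * d < N) {n : ℤ} (hn : |n| ≤ d) (c : ℝ) :
    (fun φ : ℝ => Complex.exp (((2 * Real.pi * n * (Real.sin φ - c) : ℝ) : ℂ) * Complex.I)) ∈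
      trigSpan N d := by
  have := (trigSpan N d).smul_mem
    (Complex.exp (((-(2 * Real.pi * n * c) : ℝ) : ℂ) * Complex.I)) (exp_mem_trigSpan hN hn)
  convert this using 1
  ext φ
  rw [Pi.smul_apply, smul_eq_mul, ← Complex.exp_add]
  congr 1
  push_cast
  ring

theorem cos_shift_mem_trigSpan {N d : ℕ} (hN : 2 * d < N) {n : ℤ} (hn : |n| ≤ d) (c : ℝ) :
    (fun φ : ℝ => ((Real.cos (2 * Real.pi * n * (Real.sin φ - c)) : ℝ) : ℂ)) ∈
      trigSpan N d := by
  have h1 := exp_shift_mem_trigSpan hN hn c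
  have h2 := exp_shift_mem_trigSpan hN (n := -n) (by rwa [abs_neg]) c
  convert (trigSpan N d).smul_mem (1 / 2 : ℂ) ((trigSpan N d).add_mem h1 h2) using 1
  ext φ
  rw [Pi.smul_apply, Pi.add_apply, smul_eq_mul, Complex.ofReal_cos, Complex.cos]
  push_cast
  ring_nf

theorem sin_shift_mem_trigSpan {N d : ℕ} (hN : 2 * d < N) {n : ℤ} (hn : |n| ≤ d) (c : ℝ) :
    (fun φ : ℝ => ((Real.sin (2 * Real.pi * n * (Real.sin φ - c)) : ℝ) : ℂ)) ∈
      trigSpan N d := by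
  have h1 := exp_shift_mem_trigSpan hN hn c
  have h2 := exp_shift_mem_trigSpan hN (n := -n) (by rwa [abs_neg]) c
  convert (trigSpan N d).smul_mem (Complex.I / 2 : ℂ) ((trigSpan N d).sub_mem h2 h1) using 1
  ext φ
  rw [Pi.smul_apply, Pi.sub_apply, smul_eq_mul, Complex.ofReal_sin, Complex.sin]
  push_cast
  ring_nf

theorem freqAvg_mem_trigSpan {N M : ℕ} (hM : 0 < M) (φ : ℝ → ℝ → ℝ)
    (h : ∀ n : ℤ, |n| ≤ (M - 1 : ℕ) →
      (fun x : ℝ => ((φ x (2 * n / M) : ℝ) : ℂ)) ∈ trigSpan N (M - 1)) :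
    (fun x : ℝ => ((freqAvg M (φ x) : ℝ) : ℂ)) ∈ trigSpan N (M - 1) := by
  have : (fun x : ℝ => ((freqAvg M (φ x) : ℝ) : ℂ)) = ((1 / (M : ℂ) ^ 2) •
      ∑ j ∈ range M, ∑ k ∈ range M, fun x : ℝ =>
        ((φ x (2 * (((j : ℤ) - k : ℤ) : ℝ) / M) : ℝ) : ℂ)) := by
    ext x
    simp only [freqAvg, Pi.smul_apply, Finset.sum_apply, smul_eq_mul]
    push_cast
    ring
  rw [this]
  refine Submodule.smul_mem _ _ (Submodule.sum_mem _ fun j hj => Submodule.sum_mem _ fun k hk => ?_)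
  have hj := mem_range.1 hj
  have hk := mem_range.1 hk
  exact h _ (abs_le.2 ⟨by omega, by omega⟩)

theorem fejer_mem_trigSpan {N M : ℕ} (hM : 0 < M) (hN : 2 * (M - 1) < N) (c : ℝ) :
    (fun φ : ℝ => ((fejer M (M * Real.pi * Real.sin φ - M * Real.pi * c) : ℝ) : ℂ)) ∈
      trigSpan N (M - 1) := by
  have h0 : (M : ℝ) ≠ 0 := by positivity
  refine freqAvg_mem_trigSpan hM _ fun n hn => ?_
  convert cos_shift_mem_trigSpan hN hn c using 4
  field_simp

theorem fejer₁_mem_trigSpan {N M : ℕ} (hM : 0 < M) (hN : 2 * (M - 1) < N) (c : ℝ) :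
    (fun φ : ℝ => ((fejer₁ M (M * Real.pi * Real.sin φ - M * Real.pi * c) : ℝ) : ℂ)) ∈
      trigSpan N (M - 1) := by
  have h0 : (M : ℝ) ≠ 0 := by positivity
  refine freqAvg_mem_trigSpan hM _ fun n hn => ?_
  convert (trigSpan N (M - 1)).smul_mem (-(2 * n / M : ℂ)) (sin_shift_mem_trigSpan hN hn c)
    using 1
  ext φ
  rw [Pi.smul_apply, smul_eq_mul]
  push_cast
  rw [neg_mul]
  congr 3
  field_simp

theorem norm_exp_two_pi (x : ℝ) (d : ℕ) :
    ‖Complex.exp (2 * Real.pi * Complex.I * (x : ℂ) * (d : ℂ))‖ = 1 := by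
  have : 2 * Real.pi * Complex.I * (x : ℂ) * (d : ℂ) =
      ((2 * Real.pi * x * d : ℝ) : ℂ) * Complex.I := by push_cast; ring
  rw [this, Complex.norm_exp_ofReal_mul_I]

theorem norm_arrayResponse (n : ℕ) (θ : ℝ) (j : Fin n) : ‖arrayResponse n θ j‖ = 1 := by
  exact norm_exp_two_pi (Real.sin θ) j

theorem arrayResponse_congr (N : ℕ) {φ θ : ℝ} {n : ℤ} (h : Real.sin φ = Real.sin θ + n) :
    arrayResponse N φ = arrayResponse N θ := by
  ext j
  unfold arrayResponse
  rw [h, Complex.exp_eq_exp_iff_exists_int]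
  exact ⟨n * j, by push_cast; ring⟩

/-- The property of vectors `p k` to be coefficient vectors of polynomials `P k` in
`exp (2 π i sin φ)` with `P k (θ j) = δ k j` and `∑ k, |P k| ^ 2 ≤ 1`, with equality only at the
nodes. -/
def IsInterpolating {N K : ℕ} (θ : Fin K → ℝ) (p : Fin K → Fin N → ℂ) : Prop :=
  (∀ k j, p k ⬝ᵥ arrayResponse N (θ j) = if k = j then 1 else 0) ∧
  (∀ φ, ∑ k, ‖p k ⬝ᵥ arrayResponse N φ‖ ^ 2 ≤ 1) ∧
  ∀ φ, ∑ k, ‖p k ⬝ᵥ arrayResponse N φ‖ ^ 2 = 1 →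
    ∃ j, arrayResponse N φ = arrayResponse N (θ j)

/-- With one node there is no separation and `N` may be small, so the Fejér construction is
unavailable. The normalized inner product with the array response at the node works, by the equality
case of Cauchy–Schwarz. -/
theorem exists_interpolating_one {N : ℕ} (hN : 0 < N) (θ : Fin 1 → ℝ) :
    ∃ p : Fin 1 → Fin N → ℂ, IsInterpolating θ p := by
  have hN' : (N : ℂ) ≠ 0 := by exact_mod_cast hN.ne'
  have hNr : (0 : ℝ) < N := by exact_mod_cast hN
  let e : ℝ → EuclideanSpace ℂ (Fin N) := fun φ => WithLp.toLp 2 (arrayResponse N φ)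
  have he : ∀ φ, ‖e φ‖ ^ 2 = N := fun φ => by
    rw [EuclideanSpace.norm_sq_eq]
    simp [e, norm_arrayResponse]
  let p : Fin 1 → Fin N → ℂ := fun k => (1 / (N : ℂ)) • star (arrayResponse N (θ 0))
  have hp : ∀ k φ, p k ⬝ᵥ arrayResponse N φ = 1 / (N : ℂ) * inner ℂ (e (θ 0)) (e φ) := by
    intro k φ
    rw [smul_dotProduct, smul_eq_mul, EuclideanSpace.inner_eq_star_dotProduct, dotProduct_comm]
  have hne : ∀ φ, e φ ≠ 0 := fun φ h => by
    have := he φ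
    rw [h, norm_zero, zero_pow two_ne_zero] at this
    exact hNr.ne this
  have hle : ∀ φ, ‖e φ‖ = Real.sqrt N := fun φ => by
    rw [← he φ, Real.sqrt_sq (norm_nonneg _)]
  refine ⟨p, fun k j => ?_, fun φ => ?_, fun φ h => ⟨0, ?_⟩⟩
  · rw [hp k, Subsingleton.elim j 0, inner_self_eq_norm_sq_to_K, if_pos (Subsingleton.elim _ _)]
    have := congrArg (Complex.ofReal) (he (θ 0))
    push_cast at this
    erw [this]
    field_simp
  · rw [Fin.sum_univ_one, hp 0, norm_mul]
    have h1 := norm_inner_le_norm (𝕜 := ℂ) (e (θ 0)) (e φ)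
    rw [hle, hle, Real.mul_self_sqrt hNr.le] at h1
    have h2 : ‖1 / (N : ℂ)‖ = 1 / N := by simp
    have h3 : ‖1 / (N : ℂ)‖ * ‖inner ℂ (e (θ 0)) (e φ)‖ ≤ 1 := by
      rw [h2, one_div, inv_mul_le_iff₀ hNr, mul_one]
      exact h1
    exact pow_le_one₀ (by positivity) h3
  · rw [Fin.sum_univ_one, hp 0, norm_mul] at h
    have h2 : ‖1 / (N : ℂ)‖ = 1 / N := by simp
    have h3 := (pow_eq_one_iff_of_nonneg (by positivity) two_ne_zero).1 h
    rw [h2, one_div, inv_mul_eq_iff_eq_mul₀ hNr.ne', mul_one] at h3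
    have h4 : ‖inner ℂ (e (θ 0)) (e φ)‖ = ‖e (θ 0)‖ * ‖e φ‖ := by
      rw [h3, hle, hle, Real.mul_self_sqrt hNr.le]
    obtain ⟨c, -, hc⟩ := (norm_inner_eq_norm_iff (hne _) (hne _)).1 h4
    have hc' : ∀ j, arrayResponse N φ j = c * arrayResponse N (θ 0) j := fun j =>
      congrArg (fun x : EuclideanSpace ℂ (Fin N) => x j) hc
    -- Both vectors have first entry `1`.
    have h1 : c = 1 := by
      have := hc' ⟨0, hN⟩
      simp [arrayResponse] at this
      exact this.symm
    ext j
    rw [hc', h1, one_mul]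

/-- Two distinct indices force `m = (N - 1) / 4` to be at least `3`: the threshold is then finite,
and wrapped distances are at most `1 / 2`, so `m ≥ 2.38`. -/
theorem le_wrappedDist_of_minSeparation {K N : ℕ} {θ : Fin K → ℝ}
    (h : minSeparation θ ≥ separationThreshold N) {i j : Fin K} (hij : i ≠ j) :
    3 ≤ (N - 1) / 4 ∧
      119 / 100 / (((N - 1) / 4 : ℕ) : ℝ) ≤ wrappedDist (Real.sin (θ i)) (Real.sin (θ j)) := by
  set m := (N - 1) / 4 with hm
  have h1 : separationThreshold N ≤
      ENNReal.ofReal (wrappedDist (Real.sin (θ i)) (Real.sin (θ j))) :=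
    h.trans ((iInf_le _ i).trans ((iInf_le _ j).trans (iInf_le _ hij)))
  unfold separationThreshold at h1
  have hm0 : m ≠ 0 := by
    intro h0
    rw [← hm, h0, Nat.cast_zero, ENNReal.div_zero (by simp; norm_num)] at h1
    exact absurd h1 (by simp)
  have hmr : (0 : ℝ) < m := by positivity
  have h2 : 119 / 100 / (m : ℝ) ≤ wrappedDist (Real.sin (θ i)) (Real.sin (θ j)) := by
    have e : ENNReal.ofReal 1.19 / (m : ℝ≥0∞) = ENNReal.ofReal (1.19 / m) := by
      rw [ENNReal.ofReal_div_of_pos hmr, ENNReal.ofReal_natCast]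
    rw [← hm, e] at h1
    replace h1 := (ENNReal.ofReal_le_ofReal_iff (norm_nonneg _)).1 h1
    norm_num at h1 ⊢
    exact h1
  refine ⟨?_, h2⟩
  have h3 : wrappedDist (Real.sin (θ i)) (Real.sin (θ j)) ≤ 1 / 2 := by
    unfold wrappedDist
    rw [UnitAddCircle.norm_eq]
    exact abs_sub_round _
  have h4 := h2.trans h3
  rw [div_le_iff₀ hmr] at h4
  have h5 : (2 : ℝ) < m := by linarith
  exact_mod_cast h5

theorem exists_interpolating {N K : ℕ} (hN : 0 < N) (θ : Fin K → ℝ)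
    (h : minSeparation θ ≥ separationThreshold N) :
    ∃ p : Fin K → Fin N → ℂ, IsInterpolating θ p := by
  rcases K with _ | _ | K
  · exact ⟨fun _ => 0, fun k => k.elim0, fun φ => by simp, fun φ h => by simp at h⟩
  · exact exists_interpolating_one hN θ
  set m := (N - 1) / 4 with hm
  have hm3 : 3 ≤ m := (le_wrappedDist_of_minSeparation h (i := 0) (j := 1) (by simp)).1
  -- This kernel has frequencies up to `M - 1 = 2 m`, and `2 (M - 1) = 4 m < N` fits into `N`
  -- coefficients. In the variable `M π sin θ` the separation is at least `M π * 1.19 / m ≥ 2.38 π`.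
  set M := 2 * m + 1 with hMdef
  have hM7 : 7 ≤ M := by omega
  have hM0 : 0 < M := by omega
  have hMr : (0 : ℝ) < M := by exact_mod_cast hM0
  have hMN : 2 * (M - 1) < N := by omega
  have hpi := Real.pi_pos
  let u : Fin (K + 2) → ℝ := fun j => M * Real.pi * Real.sin (θ j)
  have hsep : Separated M u := by
    intro i j hij n
    have h1 := (le_wrappedDist_of_minSeparation h hij).2
    rw [wrappedDist, UnitAddCircle.norm_eq] at h1
    have h2 := h1.trans (round_le (Real.sin (θ i) - Real.sin (θ j)) (-n))
    have hmr : (0 : ℝ) < m := by positivity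
    have h3 : u i - u j + n * (Real.pi * M) =
        M * Real.pi * (Real.sin (θ i) - Real.sin (θ j) - ((-n : ℤ) : ℝ)) := by
      simp only [u]; push_cast; ring
    rw [h3, abs_mul, abs_of_pos (by positivity)]
    have h4 : 238 / 100 ≤ (M : ℝ) * (119 / 100 / m) := by
      rw [mul_div_assoc', le_div_iff₀ hmr, hMdef]
      push_cast
      linarith
    calc 238 / 100 * Real.pi ≤ (M : ℝ) * (119 / 100 / m) * Real.pi := by gcongr
      _ = M * Real.pi * (119 / 100 / m) := by ring
      _ ≤ _ := by gcongr
  obtain ⟨a, b, hab, hlt⟩ := exists_interpolating_curve hM7 hsep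
  let P : Fin (K + 2) → ℝ → ℝ := fun k v =>
    ∑ j, (a k j * fejer M (v - u j) + b k j * fejer₁ M (v - u j))
  have hmem : ∀ k, (fun φ : ℝ => ((P k (M * Real.pi * Real.sin φ) : ℝ) : ℂ)) ∈
      trigSpan N (M - 1) := by
    intro k
    have : (fun φ : ℝ => ((P k (M * Real.pi * Real.sin φ) : ℝ) : ℂ)) =
        ∑ j, ((a k j : ℂ) • (fun φ : ℝ => ((fejer M (M * Real.pi * Real.sin φ -
          M * Real.pi * Real.sin (θ j)) : ℝ) : ℂ)) + (b k j : ℂ) • fun φ : ℝ =>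
          ((fejer₁ M (M * Real.pi * Real.sin φ - M * Real.pi * Real.sin (θ j)) : ℝ) : ℂ)) := by
      ext φ
      simp only [P, u, Finset.sum_apply, Pi.add_apply, Pi.smul_apply, smul_eq_mul]
      push_cast
      rfl
    rw [this]
    exact Submodule.sum_mem _ fun j _ => Submodule.add_mem _
      (Submodule.smul_mem _ _ (fejer_mem_trigSpan hM0 hMN _))
      (Submodule.smul_mem _ _ (fejer₁_mem_trigSpan hM0 hMN _))
  choose q hq using hmem
  let w : ℝ → ℂ := fun φ =>
    Complex.exp (2 * Real.pi * Complex.I * (Real.sin φ : ℂ) * ((M - 1 : ℕ) : ℂ))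
  have hw : ∀ φ, ‖w φ‖ = 1 := fun φ => norm_exp_two_pi (Real.sin φ) (M - 1)
  have hq : ∀ k φ, q k ⬝ᵥ arrayResponse N φ =
      w φ * ((P k (M * Real.pi * Real.sin φ) : ℝ) : ℂ) := hq
  -- The shift to nonnegative powers of `z` costs a unimodular factor `w`, normalized here so that
  -- the value at the node is exactly `1`.
  let p : Fin (K + 2) → Fin N → ℂ := fun k => (w (θ k))⁻¹ • q k
  have hp : ∀ k φ, p k ⬝ᵥ arrayResponse N φ =
      (w (θ k))⁻¹ * (w φ * ((P k (M * Real.pi * Real.sin φ) : ℝ) : ℂ)) := fun k φ => by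
    rw [smul_dotProduct, hq, smul_eq_mul]
  have hp1 : ∀ k j, p k ⬝ᵥ arrayResponse N (θ j) = if k = j then 1 else 0 := by
    intro k j
    have h1 : P k (M * Real.pi * Real.sin (θ j)) = if k = j then 1 else 0 := hab k j
    rw [hp, h1]
    split_ifs with hkj
    · have : w (θ j) ≠ 0 := by rw [← norm_ne_zero_iff, hw]; exact one_ne_zero
      rw [hkj]
      simp [this]
    · simp
  have hnorm : ∀ φ, ∑ k, ‖p k ⬝ᵥ arrayResponse N φ‖ ^ 2 =
      ∑ k, P k (M * Real.pi * Real.sin φ) ^ 2 := by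
    intro φ
    refine sum_congr rfl fun k _ => ?_
    rw [hp, norm_mul, norm_mul, norm_inv, hw, hw, inv_one, one_mul, one_mul,
      Complex.norm_real, Real.norm_eq_abs, sq_abs]
  have hnode : ∀ φ, (∃ j, arrayResponse N φ = arrayResponse N (θ j)) ∨
      ∑ k, ‖p k ⬝ᵥ arrayResponse N φ‖ ^ 2 < 1 := by
    intro φ
    by_cases hφ : ∀ j, ∀ n : ℤ, M * Real.pi * Real.sin φ ≠ u j + n * (Real.pi * M)
    · right
      rw [hnorm]
      exact hlt _ hφ
    · push Not at hφ
      obtain ⟨j, n, hn⟩ := hφ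
      refine Or.inl ⟨j, arrayResponse_congr N (n := n) ?_⟩
      have h1 : (M * Real.pi) * Real.sin φ = (M * Real.pi) * (Real.sin (θ j) + n) := by
        rw [hn]; simp only [u]; ring
      exact mul_left_cancel₀ (by positivity) h1
  refine ⟨p, hp1, fun φ => ?_, fun φ h1 => ?_⟩
  · rcases hnode φ with ⟨j, hj⟩ | hlt'
    · rw [hj]
      simp only [hp1]
      rw [sum_eq_single j (fun k _ hk => by simp [hk]) (by simp)]
      simp
    · exact hlt'.le
  · rcases hnode φ with hj | hlt'
    · exact hj
    · exact absurd h1 hlt'.ne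

/-! ### Nonnegative trigonometric polynomials as sums of squares -/

section SumOfSquares

open Polynomial

theorem hasDerivAt_circle (z₀ : ℂ) (t : ℝ) :
    HasDerivAt (fun t : ℝ => z₀ * Complex.exp (t * Complex.I))
      (z₀ * (Complex.exp (t * Complex.I) * Complex.I)) t := by
  have h1 : HasDerivAt (fun t : ℝ => (t : ℂ) * Complex.I) Complex.I t := by
    simpa using (Complex.ofRealCLM.hasDerivAt (x := t)).mul_const Complex.I
  exact (h1.cexp).const_mul z₀

theorem norm_circle {z₀ : ℂ} (h : ‖z₀‖ = 1) (t : ℝ) :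
    ‖z₀ * Complex.exp (t * Complex.I)‖ = 1 := by
  rw [norm_mul, h, one_mul, Complex.norm_exp_ofReal_mul_I]

/-- A zero of a nonnegative function on the circle is a minimum, so the derivative along the circle
vanishes and the zero is at least double. -/
theorem derivative_eval_eq_zero_of_nonneg {p : ℂ[X]} {n : ℕ}
    (hp : ∀ z : ℂ, ‖z‖ = 1 → 0 ≤ p.eval z * star z ^ n) {z₀ : ℂ} (h0 : ‖z₀‖ = 1)
    (hz : p.eval z₀ = 0) : p.derivative.eval z₀ = 0 := by
  let g : ℝ → ℂ := fun t => p.eval (z₀ * Complex.exp (t * Complex.I)) *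
    star (z₀ * Complex.exp (t * Complex.I)) ^ n
  have hg0 : g 0 = 0 := by simp [g, hz]
  have hc := hasDerivAt_circle z₀ 0
  have h1 : HasDerivAt (fun t : ℝ => p.eval (z₀ * Complex.exp (t * Complex.I)))
      (p.derivative.eval (z₀ * Complex.exp ((0 : ℝ) * Complex.I)) *
        (z₀ * (Complex.exp ((0 : ℝ) * Complex.I) * Complex.I))) 0 :=
    (p.hasDerivAt _).comp 0 hc
  have h2 : HasDerivAt (fun t : ℝ => star (z₀ * Complex.exp (t * Complex.I)) ^ n) _ 0 :=
    (hc.star).fun_pow n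
  have h3 := h1.fun_mul h2
  set d := p.derivative.eval z₀ * (z₀ * Complex.I) * star z₀ ^ n with hd
  have h4 : HasDerivAt g d 0 := by
    refine h3.congr_deriv ?_
    simp [hz, hd]
  have hre : d.re = 0 := by
    have h5 : HasDerivAt (fun t => (g t).re) d.re 0 :=
      Complex.reCLM.hasFDerivAt.comp_hasDerivAt 0 h4
    refine IsLocalMin.hasDerivAt_eq_zero (Filter.Eventually.of_forall fun t => ?_) h5
    simp only [hg0, Complex.zero_re]
    exact (Complex.le_def.1 (hp _ (norm_circle h0 t))).1
  have him : d.im = 0 := by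
    have h5 : HasDerivAt (fun t => (g t).im) d.im 0 :=
      Complex.imCLM.hasFDerivAt.comp_hasDerivAt 0 h4
    have h6 : (fun t => (g t).im) = fun _ => 0 := funext fun t =>
      (Complex.le_def.1 (hp _ (norm_circle h0 t))).2.symm
    rw [h6] at h5
    exact h5.unique (hasDerivAt_const 0 0)
  have hd0 : d = 0 := Complex.ext hre him
  have hz0 : z₀ ≠ 0 := by rw [← norm_ne_zero_iff, h0]; exact one_ne_zero
  rw [hd] at hd0
  simpa [hz0] using hd0

theorem star_mul_self_of_norm_eq_one {z : ℂ} (h : ‖z‖ = 1) : star z * z = 1 := by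
  rw [Complex.star_def, Complex.conj_mul', h]
  simp

/-- A trigonometric polynomial that is nonnegative on the unit circle is a sum of squares. -/
theorem exists_sum_sq_of_nonneg (n : ℕ) (p : ℂ[X]) (hdeg : p.natDegree ≤ 2 * n)
    (hp : ∀ z : ℂ, ‖z‖ = 1 → 0 ≤ p.eval z * star z ^ n) :
    ∃ l : List ℂ[X], (∀ h ∈ l, h.natDegree ≤ n) ∧ ∀ z : ℂ, ‖z‖ = 1 →
      p.eval z * star z ^ n = (((l.map fun h => ‖h.eval z‖ ^ 2).sum : ℝ) : ℂ) := by
  induction n generalizing p with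
  | zero =>
    obtain ⟨c, rfl⟩ := natDegree_eq_zero.1 (by omega : p.natDegree = 0)
    have hc : 0 ≤ c := by simpa using hp 1 (by simp)
    obtain ⟨r, hr, rfl⟩ : ∃ r : ℝ, 0 ≤ r ∧ (r : ℂ) = c :=
      ⟨c.re, (Complex.le_def.1 hc).1, Complex.ext (by simp) (by simpa using (Complex.le_def.1 hc).2)⟩
    refine ⟨[C ((Real.sqrt r : ℝ) : ℂ)], by simp, fun z _ => ?_⟩
    simp [Real.sq_sqrt hr]
  | succ n ih =>
    -- Subtracting the minimum `c` creates a zero on the circle itself. Its square factor is split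
    -- off to lower `n`, and `c` returns as the square of a constant; zeros off the circle are never
    -- needed.
    obtain ⟨z₀, hz₀, hmin⟩ := (isCompact_sphere (0 : ℂ) 1).exists_isMinOn
      ⟨1, by simp⟩ (f := fun z => (p.eval z * star z ^ (n + 1)).re)
      (Continuous.continuousOn (by fun_prop))
    have h0 : ‖z₀‖ = 1 := by simpa using hz₀
    have hs0 := star_mul_self_of_norm_eq_one h0
    set c := (p.eval z₀ * star z₀ ^ (n + 1)).re with hc
    have hc0 : 0 ≤ c := (Complex.le_def.1 (hp z₀ h0)).1
    have hcz : p.eval z₀ * star z₀ ^ (n + 1) = c :=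
      Complex.ext (by simp [hc]) (by simpa using (Complex.le_def.1 (hp z₀ h0)).2.symm)
    set p₁ := p - C (c : ℂ) * X ^ (n + 1) with hp₁
    have e1 : ∀ z : ℂ, ‖z‖ = 1 →
        p₁.eval z * star z ^ (n + 1) = p.eval z * star z ^ (n + 1) - c := by
      intro z hz
      simp only [hp₁, eval_sub, eval_mul, eval_C, eval_pow, eval_X]
      rw [sub_mul, mul_assoc, ← mul_pow, mul_comm z, star_mul_self_of_norm_eq_one hz]
      simp
    have hp₁n : ∀ z : ℂ, ‖z‖ = 1 → 0 ≤ p₁.eval z * star z ^ (n + 1) := by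
      intro z hz
      rw [e1 z hz, sub_nonneg, Complex.le_def]
      exact ⟨hmin (by simpa using hz), (Complex.le_def.1 (hp z hz)).2⟩
    have hroot : p₁.eval z₀ = 0 := by
      have h1 := e1 z₀ h0
      rw [hcz, sub_self] at h1
      have hz0 : star z₀ ^ (n + 1) ≠ 0 := pow_ne_zero _ (left_ne_zero_of_mul_eq_one hs0)
      exact (mul_eq_zero.1 h1).resolve_right hz0
    have hroot' := derivative_eval_eq_zero_of_nonneg hp₁n h0 hroot
    obtain ⟨q, hq⟩ := dvd_iff_isRoot.2 hroot
    have hq0 : q.IsRoot z₀ := by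
      rw [hq, derivative_mul, eval_add, eval_mul, eval_mul] at hroot'
      simpa using hroot'
    obtain ⟨q₂, hq₂⟩ := dvd_iff_isRoot.2 hq0
    have hdeg₁ : p₁.natDegree ≤ 2 * (n + 1) := by
      refine (natDegree_sub_le _ _).trans (max_le hdeg ?_)
      exact (natDegree_C_mul_X_pow_le _ _).trans (by omega)
    have hdeg₂ : (C (-z₀) * q₂).natDegree ≤ 2 * n := by
      refine (natDegree_C_mul_le _ _).trans ?_
      by_cases h : q₂ = 0
      · simp [h]
      rw [hq, hq₂, natDegree_mul (X_sub_C_ne_zero _) (mul_ne_zero (X_sub_C_ne_zero _) h),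
        natDegree_mul (X_sub_C_ne_zero _) h, natDegree_X_sub_C] at hdeg₁
      omega
    -- On the circle `(z - z₀) ^ 2 * conj z = -z₀ * |z - z₀| ^ 2`, hence the factor `C (-z₀)`.
    have key : ∀ z : ℂ, ‖z‖ = 1 → p₁.eval z * star z ^ (n + 1) =
        ((‖z - z₀‖ ^ 2 : ℝ) : ℂ) * ((C (-z₀) * q₂).eval z * star z ^ n) := by
      intro z hz
      have hs := star_mul_self_of_norm_eq_one hz
      have e2 : ((‖z - z₀‖ ^ 2 : ℝ) : ℂ) = (star z - star z₀) * (z - z₀) := by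
        rw [← star_sub, Complex.star_def, Complex.conj_mul']
        push_cast; rfl
      rw [e2, hq, hq₂]
      simp only [eval_mul, eval_sub, eval_X, eval_C, pow_succ]
      linear_combination ((z - z₀) * q₂.eval z * star z ^ n) * (hs - hs0)
    have hnn : ∀ z : ℂ, ‖z‖ = 1 → 0 ≤ (C (-z₀) * q₂).eval z * star z ^ n := by
      have h1 : ∀ z : ℂ, ‖z‖ = 1 → z ≠ z₀ → 0 ≤ (C (-z₀) * q₂).eval z * star z ^ n := by
        intro z hz hne
        have h2 := hp₁n z hz
        rw [key z hz] at h2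
        have h3 : (0 : ℂ) < ((‖z - z₀‖ ^ 2 : ℝ) : ℂ) := by
          have : 0 < ‖z - z₀‖ := norm_pos_iff.2 (sub_ne_zero.2 hne)
          exact_mod_cast (by positivity : 0 < ‖z - z₀‖ ^ 2)
        exact le_of_mul_le_mul_left (by rwa [mul_zero]) h3
      intro z hz
      by_cases hne : z = z₀
      -- At the zero itself the quotient is nonnegative by continuity along the circle.
      · subst hne
        let g : ℝ → ℂ := fun t => (C (-z) * q₂).eval (z * Complex.exp (t * Complex.I)) *
          star (z * Complex.exp (t * Complex.I)) ^ n
        have hg : Continuous g := by fun_prop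
        have h2 : Filter.Tendsto g (nhdsWithin 0 (Set.Ioi 0)) (nhds (g 0)) :=
          hg.continuousAt.tendsto.mono_left nhdsWithin_le_nhds
        have h3 : g 0 = (C (-z) * q₂).eval z * star z ^ n := by simp [g]
        rw [← h3]
        refine ge_of_tendsto h2 ?_
        filter_upwards [Ioo_mem_nhdsGT (zero_lt_one' ℝ)] with t ht
        refine h1 _ (norm_circle hz t) fun h => ?_
        have hz0 : z ≠ 0 := by rw [← norm_ne_zero_iff, hz]; exact one_ne_zero
        have h4 : Complex.exp (t * Complex.I) = 1 := mul_left_cancel₀ hz0 (by rw [h, mul_one])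
        have h5 := congrArg Complex.im h4
        rw [Complex.exp_ofReal_mul_I_im, Complex.one_im] at h5
        exact (Real.sin_pos_of_pos_of_le_one ht.1 ht.2.le).ne' h5
      · exact h1 z hz hne
    obtain ⟨l, hl, hsum⟩ := ih _ hdeg₂ hnn
    refine ⟨C ((Real.sqrt c : ℝ) : ℂ) :: l.map ((X - C z₀) * ·), ?_, fun z hz => ?_⟩
    · intro h hh
      rcases List.mem_cons.1 hh with rfl | hh
      · simp
      · obtain ⟨h', hh', rfl⟩ := List.mem_map.1 hh
        refine natDegree_mul_le.trans ?_
        rw [natDegree_X_sub_C]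
        have := hl h' hh'
        omega
    · have h1 := e1 z hz
      rw [key z hz, hsum z hz] at h1
      rw [eq_add_of_sub_eq h1.symm]
      simp only [List.map_cons, List.sum_cons, List.map_map, eval_C, Complex.norm_real,
        Real.norm_eq_abs, sq_abs, Real.sq_sqrt hc0, Function.comp_def, eval_mul, eval_sub, eval_X,
        norm_mul, mul_pow, List.sum_map_mul_left]
      push_cast
      ring

end SumOfSquares

/-! ### Toeplitz forms as linear functionals on polynomials -/

section Toeplitz

open Polynomial
open scoped Matrix

/-- The entries of `toeplitz u`, listed by diagonals from the top right to the bottom left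
corner. -/
def diagonalEntry {n : ℕ} (u : Fin n → ℂ) (l : ℕ) : ℂ :=
  if h : l < n then u ⟨n - 1 - l, by omega⟩
  else if h : l - (n - 1) < n then star (u ⟨l - (n - 1), h⟩) else 0

theorem toeplitz_apply {n : ℕ} (u : Fin n → ℂ) (i j : Fin n) :
    toeplitz u i j = diagonalEntry u (i + (n - 1 - j)) := by
  have hi := i.isLt
  have hj := j.isLt
  simp only [toeplitz, Matrix.of_apply, diagonalEntry]
  by_cases h : i ≤ j
  · have h' : (i : ℕ) ≤ j := h
    rw [if_pos h, dif_pos (by omega)]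
    congr 2
    omega
  · have h' : (j : ℕ) < i := not_le.1 h
    rw [if_neg h, dif_neg (by omega), dif_pos (by omega)]
    congr 3
    omega

/-- The linear functional that sends `X ^ l` to the `l`-th diagonal entry of `toeplitz u`. -/
noncomputable def diagonalFunctional {n : ℕ} (u : Fin n → ℂ) : ℂ[X] →ₗ[ℂ] ℂ :=
  Polynomial.lsum fun l => LinearMap.mulRight ℂ (diagonalEntry u l)

theorem diagonalFunctional_monomial {n : ℕ} (u : Fin n → ℂ) (c : ℂ) (l : ℕ) :
    diagonalFunctional u (C c * X ^ l) = c * diagonalEntry u l := by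
  rw [C_mul_X_pow_eq_monomial, diagonalFunctional, lsum_apply, sum_monomial_index _ _ (by simp)]
  simp

/-- The polynomial with coefficient vector `p`. -/
noncomputable def polyOf {n : ℕ} (p : Fin n → ℂ) : ℂ[X] := ∑ i, C (p i) * X ^ (i : ℕ)

/-- The polynomial `z ^ (n - 1) * conj (p z)` on the unit circle. -/
noncomputable def conjReverse {n : ℕ} (p : Fin n → ℂ) : ℂ[X] :=
  ∑ i, C (star (p i)) * X ^ (n - 1 - i : ℕ)

theorem polyOf_coeff {n : ℕ} {h : ℂ[X]} (hn : h.natDegree < n) :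
    polyOf (fun i : Fin n => h.coeff i) = h := by
  conv_rhs => rw [h.as_sum_range' n hn]
  rw [polyOf, ← Fin.sum_univ_eq_sum_range (fun i => monomial i (h.coeff i))]
  simp [C_mul_X_pow_eq_monomial]

theorem conjReverse_eval {n : ℕ} (p : Fin n → ℂ) {z : ℂ} (hz : ‖z‖ = 1) :
    (conjReverse p).eval z = z ^ (n - 1) * star ((polyOf p).eval z) := by
  simp only [conjReverse, polyOf, eval_finsetSum, eval_mul, eval_C, eval_pow, eval_X,
    star_sum, star_mul, star_pow, mul_sum]
  refine sum_congr rfl fun i _ => ?_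
  have h1 : z ^ (n - 1) = z ^ (n - 1 - i : ℕ) * z ^ (i : ℕ) := by
    rw [← pow_add]; congr 1; omega
  have h2 : z ^ (i : ℕ) * star z ^ (i : ℕ) = 1 := by
    rw [← mul_pow, mul_comm, star_mul_self_of_norm_eq_one hz, one_pow]
  rw [h1]
  linear_combination (-(star (p i)) * z ^ (n - 1 - i : ℕ)) * h2

theorem eval_mul_conjReverse {n : ℕ} (p : Fin n → ℂ) {z : ℂ} (hz : ‖z‖ = 1) :
    (polyOf p * conjReverse p).eval z =
      z ^ (n - 1) * ((‖(polyOf p).eval z‖ ^ 2 : ℝ) : ℂ) := by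
  rw [eval_mul, conjReverse_eval p hz, mul_left_comm, Complex.star_def, Complex.mul_conj']
  push_cast
  rfl

/-- Since entries depend only on the diagonal, the Toeplitz form is linear in the product `polyOf p
* conjReverse p`, that is, in `z ^ (n - 1) * |P z| ^ 2`. Identities between sums of squares on the
circle therefore pass to Toeplitz forms. -/
theorem diagonalFunctional_mul_conjReverse {n : ℕ} (u p : Fin n → ℂ) :
    diagonalFunctional u (polyOf p * conjReverse p) = p ⬝ᵥ toeplitz u *ᵥ star p := by
  rw [polyOf, conjReverse, sum_mul_sum]
  simp only [map_sum, dotProduct, Matrix.mulVec, mul_sum]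
  refine sum_congr rfl fun i _ => sum_congr rfl fun j _ => ?_
  have : C (p i) * X ^ (i : ℕ) * (C (star (p j)) * X ^ (n - 1 - j : ℕ)) =
      C (p i * star (p j)) * X ^ (i + (n - 1 - j) : ℕ) := by
    rw [C_mul, pow_add]; ring
  rw [this, diagonalFunctional_monomial, toeplitz_apply, Pi.star_apply]
  ring

theorem natDegree_polyOf_le {n : ℕ} (p : Fin n → ℂ) : (polyOf p).natDegree ≤ n - 1 :=
  natDegree_sum_le_of_forall_le _ _ fun i _ => (natDegree_C_mul_X_pow_le _ _).trans (by omega)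

theorem natDegree_conjReverse_le {n : ℕ} (p : Fin n → ℂ) : (conjReverse p).natDegree ≤ n - 1 :=
  natDegree_sum_le_of_forall_le _ _ fun i _ => (natDegree_C_mul_X_pow_le _ _).trans (by omega)

theorem infinite_unit_circle : {z : ℂ | ‖z‖ = 1}.Infinite := by
  have h : Set.InjOn (fun t : ℝ => Complex.exp (t * Complex.I)) (Set.Icc 0 1) := by
    intro s hs t ht hst
    have h1 := congrArg Complex.im hst
    simp only [Complex.exp_ofReal_mul_I_im] at h1
    have hpi := Real.pi_gt_three
    exact Real.injOn_sin ⟨by linarith [hs.1], by linarith [hs.2]⟩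
      ⟨by linarith [ht.1], by linarith [ht.2]⟩ h1
  refine ((Set.Icc_infinite (zero_lt_one' ℝ)).image h).mono ?_
  rintro _ ⟨t, -, rfl⟩
  exact Complex.norm_exp_ofReal_mul_I t

/-- Frequencies are sines of angles; `arg z / (2 π)` lies in `[-1 / 2, 1 / 2]`, within the range of
the sine. -/
theorem exists_angle {z : ℂ} (hz : ‖z‖ = 1) :
    ∃ φ : ℝ, z = Complex.exp (2 * Real.pi * Complex.I * (Real.sin φ : ℂ)) := by
  have hpi := Real.pi_pos
  have h1 := Complex.abs_arg_le_pi z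
  have h2 : |z.arg / (2 * Real.pi)| ≤ 1 := by
    rw [abs_div, abs_of_pos (by positivity : 0 < 2 * Real.pi), div_le_one (by positivity)]
    linarith
  refine ⟨Real.arcsin (z.arg / (2 * Real.pi)), ?_⟩
  rw [Real.sin_arcsin (abs_le.1 h2).1 (abs_le.1 h2).2]
  have h3 := Complex.norm_mul_exp_arg_mul_I z
  rw [hz, Complex.ofReal_one, one_mul] at h3
  conv_lhs => rw [← h3]
  congr 1
  have : (Real.pi : ℂ) ≠ 0 := by exact_mod_cast hpi.ne'
  push_cast
  field_simp

theorem dotProduct_arrayResponse {n : ℕ} (p : Fin n → ℂ) (φ : ℝ) :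
    p ⬝ᵥ arrayResponse n φ =
      (polyOf p).eval (Complex.exp (2 * Real.pi * Complex.I * (Real.sin φ : ℂ))) := by
  simp only [dotProduct, polyOf, eval_finsetSum, eval_mul, eval_C, eval_pow, eval_X,
    arrayResponse]
  refine sum_congr rfl fun i _ => ?_
  rw [← Complex.exp_nat_mul]
  congr 2
  ring

/-- If `∑ k, |P k| ^ 2 ≤ 1` on the unit circle, the quadratic form of a positive semidefinite
Toeplitz matrix, summed over the coefficient vectors of the `P k`, is at most its diagonal
entry. -/
theorem sum_toeplitz_form_le {n K : ℕ} (hn : 0 < n) {u : Fin n → ℂ}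
    (hu : (toeplitz u).PosSemidef) {p : Fin K → Fin n → ℂ}
    (hp : ∀ φ, ∑ k, ‖p k ⬝ᵥ arrayResponse n φ‖ ^ 2 ≤ 1) :
    ∑ k, p k ⬝ᵥ toeplitz u *ᵥ star (p k) ≤ u ⟨0, hn⟩ := by
  -- This is `z ^ (n - 1) * (1 - ∑ k, |P k| ^ 2)` on the circle. The functional sends it to the
  -- diagonal entry minus the sum of forms, and a sum of squares sends it to a nonnegative number.
  let q : ℂ[X] := X ^ (n - 1) - ∑ k, polyOf (p k) * conjReverse (p k)
  have hq : ∀ z : ℂ, ‖z‖ = 1 → q.eval z =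
      z ^ (n - 1) * ((1 - ∑ k, ‖(polyOf (p k)).eval z‖ ^ 2 : ℝ) : ℂ) := by
    intro z hz
    simp only [q, eval_sub, eval_pow, eval_X, eval_finsetSum, eval_mul_conjReverse _ hz]
    rw [← mul_sum]
    push_cast
    ring
  have hpow : ∀ z : ℂ, ‖z‖ = 1 → z ^ (n - 1) * star z ^ (n - 1) = 1 := fun z hz => by
    rw [← mul_pow, mul_comm, star_mul_self_of_norm_eq_one hz, one_pow]
  have hdeg : q.natDegree ≤ 2 * (n - 1) := by
    refine (natDegree_sub_le _ _).trans (max_le (natDegree_X_pow_le _ |>.trans (by omega)) ?_)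
    refine natDegree_sum_le_of_forall_le _ _ fun k _ => natDegree_mul_le.trans ?_
    have h1 := natDegree_polyOf_le (p k)
    have h2 := natDegree_conjReverse_le (p k)
    omega
  obtain ⟨l, hl, hsum⟩ := exists_sum_sq_of_nonneg (n - 1) q hdeg fun z hz => by
    rw [hq z hz, mul_right_comm, hpow z hz, one_mul]
    obtain ⟨φ, hφ⟩ := exists_angle hz
    have := hp φ
    simp only [dotProduct_arrayResponse, ← hφ] at this
    exact_mod_cast sub_nonneg.2 this
  let v : ℂ[X] → Fin n → ℂ := fun h i => h.coeff i
  have hv : ∀ h ∈ l, polyOf (v h) = h := fun h hh =>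
    polyOf_coeff ((hl h hh).trans_lt (by omega))
  -- Agreement on the circle, an infinite set, gives an identity of polynomials, to which the
  -- functional applies.
  have hql : q = (l.map fun h => polyOf (v h) * conjReverse (v h)).sum := by
    refine eq_of_infinite_eval_eq _ _ (infinite_unit_circle.mono fun z hz => ?_)
    have hz : ‖z‖ = 1 := hz
    have h1 : q.eval z = z ^ (n - 1) * (((l.map fun h => ‖h.eval z‖ ^ 2).sum : ℝ) : ℂ) := by
      rw [← hsum z hz, mul_left_comm, hpow z hz, mul_one]
    show q.eval z = _
    rw [h1, ← coe_evalRingHom, map_list_sum, List.map_map, ← Complex.ofRealHom_eq_coe,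
      map_list_sum, List.map_map, ← List.sum_map_mul_left]
    congr 1
    refine List.map_congr_left fun h hh => ?_
    simp only [Function.comp_apply, coe_evalRingHom]
    rw [eval_mul_conjReverse _ hz, hv h hh]
    rfl
  have hΛ : diagonalFunctional u q =
      u ⟨0, hn⟩ - ∑ k, p k ⬝ᵥ toeplitz u *ᵥ star (p k) := by
    simp only [q, map_sub, map_sum, diagonalFunctional_mul_conjReverse]
    congr 1
    have h1 := diagonalFunctional_monomial u 1 (n - 1)
    rw [C_1, one_mul, one_mul] at h1
    rw [h1, diagonalEntry, dif_pos (by omega)]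
    congr 2
    omega
  rw [← sub_nonneg, ← hΛ, hql, map_list_sum, List.map_map]
  refine List.sum_nonneg fun x hx => ?_
  obtain ⟨h, -, rfl⟩ := List.mem_map.1 hx
  simp only [Function.comp_apply]
  rw [diagonalFunctional_mul_conjReverse]
  simpa using hu.dotProduct_mulVec_nonneg (star (v h))

end Toeplitz

/-! ### The dual certificate: optimality and uniqueness -/

open scoped Matrix

theorem exists_unit_mul_eq_norm (s : ℂ) : ∃ v : ℂ, ‖v‖ = 1 ∧ v * s = (‖s‖ : ℂ) := by
  by_cases h : s = 0
  · exact ⟨1, by simp, by simp [h]⟩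
  · have h' : (‖s‖ : ℂ) ≠ 0 := by exact_mod_cast norm_ne_zero_iff.2 h
    refine ⟨(‖s‖ : ℂ) / s, ?_, by field_simp⟩
    rw [norm_div, Complex.norm_real, norm_norm, div_self (norm_ne_zero_iff.2 h)]

theorem pairing_atom {N M : ℕ} (p : Fin N → ℂ) (r : Fin M → ℂ) (φ : ℝ × ℝ) :
    p ⬝ᵥ atom N M φ *ᵥ star r =
      (p ⬝ᵥ arrayResponse N φ.1) * star (r ⬝ᵥ arrayResponse M φ.2) := by
  rw [atom, Matrix.vecMulVec_mulVec, dotProduct_smul, MulOpposite.smul_eq_mul_unop,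
    MulOpposite.unop_op, ← Matrix.star_dotProduct_star, dotProduct_comm (star _)]

theorem pairing_decomposition {N M L : ℕ} {X : Matrix (Fin N) (Fin M) ℂ} {c : Fin L → ℂ}
    {φ : Fin L → ℝ × ℝ} (h : IsDecomposition X c φ) (p : Fin N → ℂ) (r : Fin M → ℂ) :
    p ⬝ᵥ X *ᵥ star r = ∑ l, c l *
      ((p ⬝ᵥ arrayResponse N (φ l).1) * star (r ⬝ᵥ arrayResponse M (φ l).2)) := by
  rw [h.2, Matrix.sum_mulVec, dotProduct_sum]
  refine sum_congr rfl fun l _ => ?_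
  rw [Matrix.smul_mulVec, dotProduct_smul, pairing_atom, smul_eq_mul]

section Certificate

variable {N M K : ℕ} {X : Matrix (Fin N) (Fin M) ℂ} {s : Fin K → ℂ} {θ : Fin K → ℝ × ℝ}
  {p : Fin K → Fin N → ℂ} {r : Fin K → Fin M → ℂ}

theorem pairing_eq_coefficient (hX : IsDecomposition X s θ)
    (hp : IsInterpolating (fun k => (θ k).1) p) (hr : IsInterpolating (fun k => (θ k).2) r)
    (k : Fin K) : p k ⬝ᵥ X *ᵥ star (r k) = s k := by
  rw [pairing_decomposition hX]
  have h1 : ∀ j, p k ⬝ᵥ arrayResponse N (θ j).1 = if k = j then 1 else 0 := hp.1 k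
  have h2 : ∀ j, r k ⬝ᵥ arrayResponse M (θ j).2 = if k = j then 1 else 0 := hr.1 k
  simp [h1, h2]

/-- The value at the angles `φ` of the dual certificate with signs `v`. -/
noncomputable def certificate (p : Fin K → Fin N → ℂ) (r : Fin K → Fin M → ℂ) (v : Fin K → ℂ)
    (φ : ℝ × ℝ) : ℂ :=
  ∑ k, v k * ((p k ⬝ᵥ arrayResponse N φ.1) * star (r k ⬝ᵥ arrayResponse M φ.2))

/-- `a b ≤ (a ^ 2 + b ^ 2) / 2` term by term: this separates the two dimensions. -/
theorem norm_certificate_le (v : Fin K → ℂ) (hv : ∀ k, ‖v k‖ ≤ 1) (φ : ℝ × ℝ) :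
    ‖certificate p r v φ‖ ≤ (∑ k, ‖p k ⬝ᵥ arrayResponse N φ.1‖ ^ 2 +
      ∑ k, ‖r k ⬝ᵥ arrayResponse M φ.2‖ ^ 2) / 2 := by
  refine (norm_sum_le _ _).trans ?_
  rw [← sum_add_distrib, sum_div]
  refine sum_le_sum fun k _ => ?_
  rw [norm_mul, norm_mul, norm_star]
  set a := ‖p k ⬝ᵥ arrayResponse N φ.1‖ with ha
  set b := ‖r k ⬝ᵥ arrayResponse M φ.2‖ with hb
  have ha0 : 0 ≤ a := norm_nonneg _
  have hb0 : 0 ≤ b := norm_nonneg _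
  calc ‖v k‖ * (a * b) ≤ 1 * (a * b) := by gcongr; exact hv k
    _ ≤ _ := by nlinarith [sq_nonneg (a - b)]

theorem norm_certificate_le_one (hp : IsInterpolating (fun k => (θ k).1) p)
    (hr : IsInterpolating (fun k => (θ k).2) r) (v : Fin K → ℂ) (hv : ∀ k, ‖v k‖ ≤ 1)
    (φ : ℝ × ℝ) : ‖certificate p r v φ‖ ≤ 1 := by
  have := norm_certificate_le (p := p) (r := r) v hv φ
  linarith [hp.2.1 φ.1, hr.2.1 φ.2]

/-- Modulus `1` forces equality in both one-dimensional bounds, so each coordinate sits at a node,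
with indices `i` and `j`. There the certificate is `v i` if `i = j` and zero otherwise, which
excludes the mixed grid points. -/
theorem exists_atom_eq_of_norm_certificate (hp : IsInterpolating (fun k => (θ k).1) p)
    (hr : IsInterpolating (fun k => (θ k).2) r) (v : Fin K → ℂ) (hv : ∀ k, ‖v k‖ ≤ 1)
    {φ : ℝ × ℝ} (h : ‖certificate p r v φ‖ = 1) :
    ∃ k, v k ≠ 0 ∧ atom N M φ = atom N M (θ k) := by
  have h1 := norm_certificate_le (p := p) (r := r) v hv φ
  have h2 := hp.2.1 φ.1
  have h3 := hr.2.1 φ.2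
  obtain ⟨i, hi⟩ := hp.2.2 φ.1 (by linarith)
  obtain ⟨j, hj⟩ := hr.2.2 φ.2 (by linarith)
  have e1 : ∀ k, p k ⬝ᵥ arrayResponse N φ.1 = if k = i then 1 else 0 := fun k => by
    rw [hi]; exact hp.1 k i
  have e2 : ∀ k, r k ⬝ᵥ arrayResponse M φ.2 = if k = j then 1 else 0 := fun k => by
    rw [hj]; exact hr.1 k j
  have e3 : certificate p r v φ = if i = j then v i else 0 := by
    unfold certificate
    simp only [e1, e2]
    rw [sum_eq_single i (fun k _ hk => by simp [hk]) (by simp), if_pos rfl]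
    split_ifs <;> simp
  rw [e3] at h
  split_ifs at h with hij
  · refine ⟨i, fun h0 => by simp [h0] at h, ?_⟩
    rw [atom, atom, hi, hj, ← hij]
  · simp at h

theorem sum_mul_certificate {L : ℕ} {c : Fin L → ℂ} {φ : Fin L → ℝ × ℝ}
    (hX : IsDecomposition X s θ) (hp : IsInterpolating (fun k => (θ k).1) p)
    (hr : IsInterpolating (fun k => (θ k).2) r) (hc : IsDecomposition X c φ) (v : Fin K → ℂ) :
    ∑ l, c l * certificate p r v (φ l) = ∑ k, v k * s k := by
  simp only [certificate, mul_sum]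
  rw [sum_comm]
  refine sum_congr rfl fun k _ => ?_
  rw [← pairing_eq_coefficient hX hp hr k, pairing_decomposition hc, mul_sum]
  exact sum_congr rfl fun l _ => mul_left_comm _ _ _

/-- The value `0` at zero coefficients, instead of an arbitrary unit, keeps the atoms with `s k = 0`
out of the support of optimal decompositions. -/
theorem exists_signs (s : Fin K → ℂ) :
    ∃ v : Fin K → ℂ, (∀ k, ‖v k‖ ≤ 1) ∧ (∀ k, s k = 0 → v k = 0) ∧
      ∀ k, v k * s k = (‖s k‖ : ℂ) := by
  choose v hv hs using fun k => exists_unit_mul_eq_norm (s k)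
  refine ⟨fun k => if s k = 0 then 0 else v k, fun k => ?_, fun k h => by simp [h], fun k => ?_⟩
  · by_cases h : s k = 0 <;> simp [h, hv]
  · by_cases h : s k = 0
    · simp [h]
    · simp [h, hs]

theorem cost_le_sum_certificate {L : ℕ} {c : Fin L → ℂ} {φ : Fin L → ℝ × ℝ}
    (hX : IsDecomposition X s θ) (hp : IsInterpolating (fun k => (θ k).1) p)
    (hr : IsInterpolating (fun k => (θ k).2) r) (hc : IsDecomposition X c φ) {v : Fin K → ℂ}
    (hv : ∀ k, v k * s k = (‖s k‖ : ℂ)) :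
    cost s ≤ ∑ l, ‖c l‖ * ‖certificate p r v (φ l)‖ := by
  have h1 : ((cost s : ℝ) : ℂ) = ∑ l, c l * certificate p r v (φ l) := by
    rw [sum_mul_certificate hX hp hr hc, cost]
    push_cast
    exact sum_congr rfl fun k _ => (hv k).symm
  have h0 : 0 ≤ cost s := sum_nonneg fun k _ => norm_nonneg _
  have h2 : cost s = ‖((cost s : ℝ) : ℂ)‖ := by
    rw [Complex.norm_real, Real.norm_of_nonneg h0]
  rw [h2, h1]
  exact (norm_sum_le _ _).trans (le_of_eq (sum_congr rfl fun l _ => norm_mul _ _))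

theorem atomicNorm_eq_cost (hX : IsDecomposition X s θ)
    (hp : IsInterpolating (fun k => (θ k).1) p) (hr : IsInterpolating (fun k => (θ k).2) r) :
    atomicNorm X = cost s := by
  obtain ⟨v, hv1, -, hvs⟩ := exists_signs s
  refine IsLeast.csInf_eq ⟨⟨K, s, θ, hX, rfl⟩, ?_⟩
  rintro _ ⟨L, c, φ, hc, rfl⟩
  refine (cost_le_sum_certificate hX hp hr hc hvs).trans (sum_le_sum fun l _ => ?_)
  exact mul_le_of_le_one_right (norm_nonneg _) (norm_certificate_le_one hp hr v hv1 _)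

/-- Optimality makes the duality inequality an equality term by term, so the certificate has modulus
`1` wherever `c l ≠ 0`. -/
theorem exists_atom_eq_of_optimal {L : ℕ} {c : Fin L → ℂ} {φ : Fin L → ℝ × ℝ}
    (hX : IsDecomposition X s θ) (hp : IsInterpolating (fun k => (θ k).1) p)
    (hr : IsInterpolating (fun k => (θ k).2) r) (hc : IsOptimalDecomposition X c φ)
    {l : Fin L} (hl : c l ≠ 0) : ∃ k, s k ≠ 0 ∧ atom N M (φ l) = atom N M (θ k) := by
  obtain ⟨v, hv1, hv0, hvs⟩ := exists_signs s
  have h1 := cost_le_sum_certificate hX hp hr hc.1 hvs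
  rw [← atomicNorm_eq_cost hX hp hr, ← hc.2, cost] at h1
  have h2 : ∀ l ∈ univ, ‖c l‖ * ‖certificate p r v (φ l)‖ ≤ ‖c l‖ := fun l _ =>
    mul_le_of_le_one_right (norm_nonneg _) (norm_certificate_le_one hp hr v hv1 _)
  have h3 := (sum_eq_sum_iff_of_le h2).1 (le_antisymm (sum_le_sum h2) h1) l (mem_univ l)
  have h4 : ‖certificate p r v (φ l)‖ = 1 :=
    (mul_eq_left₀ (norm_ne_zero_iff.2 hl)).1 h3
  obtain ⟨k, hk, e⟩ := exists_atom_eq_of_norm_certificate hp hr v hv1 h4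
  exact ⟨k, fun h => hk (hv0 k h), e⟩

/-- Pairing with `p k` and `r k` is the functional dual to the `k`-th atom; once the support is
known, it reads off the total coefficient. -/
theorem coefficientAt_eq_of_optimal {L : ℕ} {c : Fin L → ℂ} {φ : Fin L → ℝ × ℝ}
    (hX : IsDecomposition X s θ) (hp : IsInterpolating (fun k => (θ k).1) p)
    (hr : IsInterpolating (fun k => (θ k).2) r) (hc : IsOptimalDecomposition X c φ)
    (k : Fin K) : coefficientAt c φ (atom N M (θ k)) = s k := by
  have hpair : ∀ j, p k ⬝ᵥ atom N M (θ j) *ᵥ star (r k) = if k = j then 1 else 0 := by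
    intro j
    have h1 : p k ⬝ᵥ arrayResponse N (θ j).1 = if k = j then 1 else 0 := hp.1 k j
    have h2 : r k ⬝ᵥ arrayResponse M (θ j).2 = if k = j then 1 else 0 := hr.1 k j
    rw [pairing_atom, h1, h2]
    split_ifs <;> simp
  rw [← pairing_eq_coefficient hX hp hr k, pairing_decomposition hc.1, coefficientAt]
  refine sum_congr rfl fun l _ => ?_
  by_cases hl : c l = 0
  · simp [hl]
  obtain ⟨j, -, hj⟩ := exists_atom_eq_of_optimal hX hp hr hc hl
  rw [← pairing_atom, hj, hpair]
  by_cases hkj : k = j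
  · rw [if_pos (by rw [hkj]), if_pos hkj, mul_one]
  · rw [if_neg hkj, mul_zero, if_neg]
    intro h
    have h1 := hpair j
    rw [h, hpair k, if_pos rfl, if_neg hkj] at h1
    exact one_ne_zero h1

end Certificate

/-! ### The semidefinite program -/

section SDP

theorem trace_toeplitz {n : ℕ} (hn : 0 < n) (u : Fin n → ℂ) :
    (toeplitz u).trace = n * u ⟨0, hn⟩ := by
  have h : ∀ i, toeplitz u i i = u ⟨0, hn⟩ := fun i => by simp [toeplitz]
  simp only [Matrix.trace, Matrix.diag_apply, h]
  simp

/-- The block matrix is tested on one vector per `k`, and the inequalities are summed. The cross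
terms give the cost by `pairing_eq_coefficient`; the Toeplitz terms are bounded by the traces
through `sum_toeplitz_form_le`. -/
theorem cost_le_sdpObjective {N M K : ℕ} (hN : 0 < N) (hM : 0 < M)
    {X : Matrix (Fin N) (Fin M) ℂ} {s : Fin K → ℂ} {θ : Fin K → ℝ × ℝ}
    {p : Fin K → Fin N → ℂ} {r : Fin K → Fin M → ℂ} (hX : IsDecomposition X s θ)
    (hp : IsInterpolating (fun k => (θ k).1) p) (hr : IsInterpolating (fun k => (θ k).2) r)
    {ux : Fin N → ℂ} {uy : Fin M → ℂ} (h : SDPFeasible X ux uy) :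
    cost s ≤ sdpObjective ux uy := by
  have hN' : (0 : ℝ) < N := by exact_mod_cast hN
  have hM' : (0 : ℝ) < M := by exact_mod_cast hM
  have hTx : (toeplitz ux).PosSemidef := Matrix.PosSemidef.submatrix h Sum.inr
  have hTy : (toeplitz uy).PosSemidef := Matrix.PosSemidef.submatrix h Sum.inl
  have hsx := (Complex.le_def.1 (sum_toeplitz_form_le hN hTx hp.2.1)).1
  have hsy := (Complex.le_def.1 (sum_toeplitz_form_le hM hTy hr.2.1)).1
  rw [Complex.re_sum] at hsx hsy
  set a := Real.sqrt N with ha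
  set b := Real.sqrt M with hb
  have ha2 : a * a = N := Real.mul_self_sqrt hN'.le
  have hb2 : b * b = M := Real.mul_self_sqrt hM'.le
  have hk : ∀ k, 2 * (a * b) * ‖s k‖ ≤ N * (p k ⬝ᵥ toeplitz ux *ᵥ star (p k)).re +
      M * (r k ⬝ᵥ toeplitz uy *ᵥ star (r k)).re := by
    intro k
    obtain ⟨v, hv, hvs⟩ := exists_unit_mul_eq_norm (s k)
    -- The weights `√M` and `√N` turn the bounds by diagonal entries into traces; the phase `v` and
    -- the sign make the cross terms equal to `-√(N M) * |s k|`.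
    let η : Fin M → ℂ := (b : ℂ) • star (r k)
    let ζ : Fin N → ℂ := (-(a * star v) : ℂ) • star (p k)
    have h1 := h.dotProduct_mulVec_nonneg (Sum.elim η ζ)
    have hsη : star η = (b : ℂ) • r k := by simp [η, star_smul]
    have hsζ : star ζ = (-(a * v) : ℂ) • p k := by simp [ζ, star_smul]
    have e1 : star (Sum.elim η ζ) = Sum.elim (star η) (star ζ) := by
      ext i; cases i <;> rfl
    have hXζ : star ζ ⬝ᵥ X *ᵥ η = ((-(a * b * ‖s k‖) : ℝ) : ℂ) := by
      rw [hsζ, Matrix.mulVec_smul, smul_dotProduct, dotProduct_smul,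
        pairing_eq_coefficient hX hp hr k, smul_eq_mul, smul_eq_mul]
      push_cast
      rw [← hvs]
      ring
    have hXη : star η ⬝ᵥ X.conjTranspose *ᵥ ζ = ((-(a * b * ‖s k‖) : ℝ) : ℂ) := by
      have h2 := congrArg star hXζ
      rw [Matrix.star_dotProduct, star_star, Matrix.star_mulVec, ← Matrix.dotProduct_mulVec,
        Complex.star_def, Complex.conj_ofReal] at h2
      exact h2
    rw [e1, Matrix.fromBlocks_mulVec, sumElim_dotProduct_sumElim] at h1
    simp only [Sum.elim_comp_inl, Sum.elim_comp_inr, dotProduct_add] at h1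
    rw [hXζ, hXη, hsη, hsζ, Matrix.mulVec_smul, Matrix.mulVec_smul] at h1
    simp only [smul_dotProduct, dotProduct_smul, smul_eq_mul] at h1
    have h2 : -((a : ℂ) * star v) * (-((a : ℂ) * v) * (p k ⬝ᵥ toeplitz ux *ᵥ star (p k))) =
        ((N : ℝ) : ℂ) * (p k ⬝ᵥ toeplitz ux *ᵥ star (p k)) := by
      have hvv := star_mul_self_of_norm_eq_one hv
      rw [← ha2]
      push_cast
      linear_combination (a * a * (p k ⬝ᵥ toeplitz ux *ᵥ star (p k)) : ℂ) * hvv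
    have h3 : (b : ℂ) * ((b : ℂ) * (r k ⬝ᵥ toeplitz uy *ᵥ star (r k))) =
        ((M : ℝ) : ℂ) * (r k ⬝ᵥ toeplitz uy *ᵥ star (r k)) := by
      rw [← hb2]
      push_cast
      ring
    rw [h2, h3] at h1
    have h4 := (Complex.le_def.1 h1).1
    simp only [Complex.add_re, Complex.re_ofReal_mul, Complex.ofReal_re, Complex.zero_re] at h4
    linarith
  have hsum : 2 * (a * b) * cost s ≤ N * (ux ⟨0, hN⟩).re + M * (uy ⟨0, hM⟩).re := by
    calc 2 * (a * b) * cost s ≤ ∑ k, (N * (p k ⬝ᵥ toeplitz ux *ᵥ star (p k)).re +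
          M * (r k ⬝ᵥ toeplitz uy *ᵥ star (r k)).re) := by
          rw [cost, mul_sum]
          exact sum_le_sum fun k _ => hk k
      _ ≤ _ := by
          rw [sum_add_distrib, ← mul_sum, ← mul_sum]
          gcongr
  have hsqrt : Real.sqrt ((N : ℝ) * M) = a * b := Real.sqrt_mul hN'.le _
  have hab : 0 < a * b := mul_pos (Real.sqrt_pos.2 hN') (Real.sqrt_pos.2 hM')
  have htr : (toeplitz ux).trace.re + (toeplitz uy).trace.re =
      N * (ux ⟨0, hN⟩).re + M * (uy ⟨0, hM⟩).re := by
    rw [trace_toeplitz hN, trace_toeplitz hM]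
    simp
  rw [sdpObjective, hsqrt, htr, one_div, ← div_eq_inv_mul, le_div_iff₀ (by positivity)]
  linarith

theorem arrayResponse_mul_star {n : ℕ} (θ : ℝ) (i j : Fin n) (hij : i ≤ j) :
    arrayResponse n θ i * star (arrayResponse n θ j) =
      star (arrayResponse n θ ⟨(j : ℕ) - i, lt_of_le_of_lt (Nat.sub_le _ _) j.isLt⟩) := by
  have hij' : (i : ℕ) ≤ j := hij
  have h1 : arrayResponse n θ j = arrayResponse n θ i *
      arrayResponse n θ ⟨(j : ℕ) - i, lt_of_le_of_lt (Nat.sub_le _ _) j.isLt⟩ := by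
    simp only [arrayResponse]
    rw [← Complex.exp_add, Nat.cast_sub hij']
    congr 1
    ring
  have h2 := star_mul_self_of_norm_eq_one (norm_arrayResponse n θ i)
  rw [h1, star_mul]
  linear_combination
    star (arrayResponse n θ ⟨(j : ℕ) - i, lt_of_le_of_lt (Nat.sub_le _ _) j.isLt⟩) * h2

theorem toeplitz_sum_arrayResponse {n K : ℕ} (c : Fin K → ℝ) (θ : Fin K → ℝ) :
    toeplitz (fun j : Fin n => ∑ k, (c k : ℂ) * star (arrayResponse n (θ k) j)) =
      ∑ k, (c k : ℂ) • Matrix.vecMulVec (arrayResponse n (θ k))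
        (star (arrayResponse n (θ k))) := by
  ext i j
  rw [Matrix.sum_apply]
  simp only [Matrix.smul_apply, Matrix.vecMulVec_apply, Pi.star_apply, smul_eq_mul]
  simp only [toeplitz, Matrix.of_apply]
  split_ifs with h
  · refine sum_congr rfl fun k _ => ?_
    rw [arrayResponse_mul_star _ _ _ h]
  · rw [star_sum]
    refine sum_congr rfl fun k _ => ?_
    have h1 := congrArg star (arrayResponse_mul_star (θ k) j i (not_le.1 h).le)
    rw [star_mul, star_star] at h1
    rw [star_mul, h1, star_star, Complex.star_def, Complex.conj_ofReal, mul_comm]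

theorem exists_feasible {N M K : ℕ} (hN : 0 < N) (hM : 0 < M) {X : Matrix (Fin N) (Fin M) ℂ}
    {s : Fin K → ℂ} {θ : Fin K → ℝ × ℝ} (hX : IsDecomposition X s θ) :
    ∃ (ux : Fin N → ℂ) (uy : Fin M → ℂ), SDPFeasible X ux uy ∧
      cost s = sdpObjective ux uy := by
  have hN' : (0 : ℝ) < N := by exact_mod_cast hN
  have hM' : (0 : ℝ) < M := by exact_mod_cast hM
  set a := Real.sqrt N with ha
  set b := Real.sqrt M with hb
  have ha0 : 0 < a := Real.sqrt_pos.2 hN'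
  have hb0 : 0 < b := Real.sqrt_pos.2 hM'
  have ha2 : a ^ 2 = N := Real.sq_sqrt hN'.le
  have hb2 : b ^ 2 = M := Real.sq_sqrt hM'.le
  -- The weights have product `|s k| ^ 2`, as the off-diagonal block requires, and are balanced so
  -- that both traces equal `√(N M) * ∑ |s k|`.
  let cx : Fin K → ℝ := fun k => ‖s k‖ * (b / a)
  let cy : Fin K → ℝ := fun k => ‖s k‖ * (a / b)
  have hcx : ∀ k, 0 ≤ cx k := fun k => by positivity
  have hcy : ∀ k, 0 ≤ cy k := fun k => by positivity
  have hcc : ∀ k, Real.sqrt (cx k) * Real.sqrt (cy k) = ‖s k‖ := fun k => by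
    rw [← Real.sqrt_mul (hcx k), ← Real.sqrt_sq (norm_nonneg (s k))]
    congr 1
    simp only [cx, cy]
    field_simp
  choose v hv hvs using fun k => exists_unit_mul_eq_norm (s k)
  let w : Fin K → Fin M ⊕ Fin N → ℂ := fun k =>
    Sum.elim ((Real.sqrt (cy k) : ℂ) • arrayResponse M (θ k).2)
      ((star (v k) * Real.sqrt (cx k) : ℂ) • arrayResponse N (θ k).1)
  -- The first row of `a aᴴ` is the conjugate of `a`, as `a` has first entry `1`.
  refine ⟨fun j => ∑ k, (cx k : ℂ) * star (arrayResponse N (θ k).1 j),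
    fun j => ∑ k, (cy k : ℂ) * star (arrayResponse M (θ k).2 j), ?_, ?_⟩
  · unfold SDPFeasible
    have hw : Matrix.fromBlocks
        (toeplitz fun j => ∑ k, (cy k : ℂ) * star (arrayResponse M (θ k).2 j))
        X.conjTranspose X
        (toeplitz fun j => ∑ k, (cx k : ℂ) * star (arrayResponse N (θ k).1 j)) =
        ∑ k, Matrix.vecMulVec (w k) (star (w k)) := by
      rw [toeplitz_sum_arrayResponse cx fun k => (θ k).1,
        toeplitz_sum_arrayResponse cy fun k => (θ k).2]
      have hsq : ∀ x : ℝ, 0 ≤ x → (x : ℂ) = (Real.sqrt x : ℂ) * (Real.sqrt x : ℂ) :=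
        fun x hx => by exact_mod_cast (Real.mul_self_sqrt hx).symm
      have hreal : ∀ x : ℝ, star (x : ℂ) = x := Complex.conj_ofReal
      have hvv : ∀ k, star (v k) * v k = 1 := fun k => star_mul_self_of_norm_eq_one (hv k)
      have hs : ∀ k, s k = star (v k) * ((Real.sqrt (cx k) : ℂ) * (Real.sqrt (cy k) : ℂ)) := by
        intro k
        have h1 : ((Real.sqrt (cx k) : ℂ) * (Real.sqrt (cy k) : ℂ)) = (‖s k‖ : ℂ) := by
          exact_mod_cast hcc k
        rw [h1, ← hvs, ← mul_assoc, hvv, one_mul]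
      have hXe : ∀ i j, X i j = ∑ k, (star (v k) * Real.sqrt (cx k) * arrayResponse N (θ k).1 i) *
          star ((Real.sqrt (cy k) : ℂ) * arrayResponse M (θ k).2 j) := by
        intro i j
        rw [hX.2, Matrix.sum_apply]
        refine sum_congr rfl fun k _ => ?_
        rw [Matrix.smul_apply, atom, Matrix.vecMulVec_apply, Pi.star_apply, smul_eq_mul, star_mul,
          hreal, hs k]
        ring
      ext i j
      rw [Matrix.sum_apply]
      rcases i with i | i <;> rcases j with j | j
      · rw [Matrix.fromBlocks_apply₁₁, Matrix.sum_apply]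
        refine sum_congr rfl fun k _ => ?_
        simp only [w, Matrix.smul_apply, Matrix.vecMulVec_apply, Pi.star_apply, Sum.elim_inl,
          Pi.smul_apply, smul_eq_mul, star_mul, Complex.star_def, Complex.conj_ofReal]
        rw [hsq _ (hcy k)]
        ring
      · rw [Matrix.fromBlocks_apply₁₂, Matrix.conjTranspose_apply, hXe, star_sum]
        refine sum_congr rfl fun k _ => ?_
        simp only [w, Matrix.vecMulVec_apply, Pi.star_apply, Sum.elim_inl, Sum.elim_inr,
          Pi.smul_apply, smul_eq_mul, star_mul, star_star]
      · rw [Matrix.fromBlocks_apply₂₁, hXe]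
        refine sum_congr rfl fun k _ => ?_
        simp only [w, Matrix.vecMulVec_apply, Pi.star_apply, Sum.elim_inl, Sum.elim_inr,
          Pi.smul_apply, smul_eq_mul]
      · rw [Matrix.fromBlocks_apply₂₂, Matrix.sum_apply]
        refine sum_congr rfl fun k _ => ?_
        have h2 := hvv k
        simp only [w, Matrix.smul_apply, Matrix.vecMulVec_apply, Pi.star_apply, Sum.elim_inr,
          Pi.smul_apply, smul_eq_mul, star_mul, star_star]
        rw [hsq _ (hcx k), hreal]
        linear_combination (-(Real.sqrt (cx k) : ℂ) * (Real.sqrt (cx k) : ℂ) *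
          arrayResponse N (θ k).1 i * star (arrayResponse N (θ k).1 j)) * h2
    rw [hw]
    exact Matrix.posSemidef_sum _ fun k _ => Matrix.posSemidef_vecMulVec_self_star _
  · have h0 : ∀ (n : ℕ) (hn : 0 < n) (t : ℝ), arrayResponse n t ⟨0, hn⟩ = 1 := by
      intro n hn t
      simp [arrayResponse]
    rw [sdpObjective, trace_toeplitz hN, trace_toeplitz hM, Real.sqrt_mul hN'.le]
    simp only [h0, star_one, mul_one, ← Complex.ofReal_sum, ← Complex.ofReal_natCast,
      ← Complex.ofReal_mul, Complex.ofReal_re]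
    simp only [cx, cy, ← sum_mul, ← ha, ← hb]
    rw [← ha2, ← hb2, cost]
    field_simp
    ring

end SDP

end DecoupledANM

theorem theorem1 (N M K : ℕ) (hN : 0 < N) (hM : 0 < M)
    (X : Matrix (Fin N) (Fin M) ℂ) (s : Fin K → ℂ) (θ : Fin K → ℝ × ℝ)
    (hX : DecoupledANM.IsDecomposition X s θ)
    (hx : DecoupledANM.minSeparation (fun k => (θ k).1) ≥ DecoupledANM.separationThreshold N)
    (hy : DecoupledANM.minSeparation (fun k => (θ k).2) ≥ DecoupledANM.separationThreshold M) :
    -- the given decomposition is optimal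
    DecoupledANM.IsOptimalDecomposition X s θ ∧
    -- it is the only optimal one: every optimal decomposition uses, with nonzero coefficients,
    -- only atoms of the given one, and its total coefficient at the `k`-th atom is `s k`
    (∀ (L : ℕ) (c : Fin L → ℂ) (φ : Fin L → ℝ × ℝ),
      DecoupledANM.IsOptimalDecomposition X c φ →
        (∀ l, c l ≠ 0 → ∃ k, s k ≠ 0 ∧
          DecoupledANM.atom N M (φ l) = DecoupledANM.atom N M (θ k)) ∧
        ∀ k, DecoupledANM.coefficientAt c φ (DecoupledANM.atom N M (θ k)) = s k) ∧
    -- the atomic norm is the (attained) minimum of the semidefinite program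
    IsLeast {r : ℝ | ∃ (ux : Fin N → ℂ) (uy : Fin M → ℂ),
        DecoupledANM.SDPFeasible X ux uy ∧ r = DecoupledANM.sdpObjective ux uy}
      (DecoupledANM.atomicNorm X) := by
  obtain ⟨p, hp⟩ := DecoupledANM.exists_interpolating hN (fun k => (θ k).1) hx
  obtain ⟨r, hr⟩ := DecoupledANM.exists_interpolating hM (fun k => (θ k).2) hy
  have hnorm := DecoupledANM.atomicNorm_eq_cost hX hp hr
  refine ⟨⟨hX, hnorm.symm⟩, fun L c φ hc =>
    ⟨fun l hl => DecoupledANM.exists_atom_eq_of_optimal hX hp hr hc hl,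
      DecoupledANM.coefficientAt_eq_of_optimal hX hp hr hc⟩, ?_, ?_⟩
  · rw [hnorm]
    exact DecoupledANM.exists_feasible hN hM hX
  · rintro _ ⟨ux, uy, h, rfl⟩
    rw [hnorm]
    exact DecoupledANM.cost_le_sdpObjective hN hM hX hp hr h
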